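/- For integers $1\le d<D$, a compact set $\mathcal K\subset\mathbb R^D$ and $\kappa>0$, let $\mathcal M=\mathcal M(\kappa)$ be the class of all nonempty compact smooth $d$-dimensional embedded submanifolds $M$ of $\mathbb R^D$ without boundary such that $M\subset\mathcal K$ and $\Delta(M)\ge\kappa$. Here the condition number (reach) $\Delta(M)$ is the largest $r\in[0,\infty]$ such that each point at distance less than $r$ from $M$ has a unique nearest point in $M$. For $\gamma>0$ let $N(\gamma,\mathcal M,H)$ be the smallest cardinality of a set $\{M_1,\dots,M_N\}\subset\mathcal M$ such that every $M\in\mathcal M$ satisfies $H(M,M_j)\le\gamma$ for some $j$, where $H$ is the Hausdorff distance with respect to the Euclidean norm. Theorem. There is an absolute constant $c_1>0$ and, for all $d\ge1$, $\kappa>0$ and $L>0$, a constant $c_2>0$ that depends only on $\kappa$, $d$ and $L$ (in particular, not on $D$ and $\gamma$), such that for all $D>d$, all compact $\mathcal K\subset\mathbb R^D$ of diameter at most $L$, and all $\gamma>0$, the covering number is finite and $$N(\gamma,\mathcal M,H)\le c_1\,\kappa_2(\kappa,d,D)\,\exp\!\left(\kappa_3(\kappa,d,D)\,\gamma^{-d/2}\right),$$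 where $$\kappa_2(\kappa,d,D)=\binom Dd^{(c_2/\kappa)^D},\qquad \kappa_3(\kappa,d,D)=2^{d/2}\,(D-d)\,(c_2/\kappa)^D .$$ -/

import Mathlib

open scoped NNReal ENNReal ContDiff

/-- `M ⊆ ℝᴰ` is a smooth (`C^∞`) embedded `d`-dimensional submanifold without boundary: around each
of its points there is a smooth local diffeomorphism `φ` of `ℝᴰ` (a slice chart) which straightens
`M`, i.e. `M` is given, in the domain of `φ`, by the vanishing of the last `D - d` coordinates
of `φ`. -/
def IsSmoothSubmanifold {D : ℕ} (d : ℕ) (M : Set (EuclideanSpace ℝ (Fin D))) : Prop :=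
  ∀ x ∈ M, ∃ φ : OpenPartialHomeomorph (EuclideanSpace ℝ (Fin D)) (EuclideanSpace ℝ (Fin D)),
    x ∈ φ.source ∧
    ContDiffOn ℝ ∞ φ φ.source ∧
    ContDiffOn ℝ ∞ φ.symm φ.target ∧
    ∀ y ∈ φ.source, y ∈ M ↔ ∀ i : Fin D, d ≤ (i : ℕ) → φ y i = 0

/-- The condition number (reach, thickness) `Δ(M) ∈ [0, ∞]`: the largest `r` such that each point
of the open `r`-neighbourhood `M ⊕ r` of `M` has a unique nearest point (projection) in `M`. -/
noncomputable def conditionNumber {D : ℕ} (M : Set (EuclideanSpace ℝ (Fin D))) : ℝ≥0∞ :=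
  ⨆ (r : ℝ≥0) (_ : ∀ z ∈ Metric.thickening (r : ℝ) M,
    ∃! p, p ∈ M ∧ dist z p = Metric.infDist z M), (r : ℝ≥0∞)

/-- The class `𝓜(κ)` of all nonempty compact smooth `d`-dimensional submanifolds without boundary
of `ℝᴰ` that are contained in `K` and satisfy `Δ(M) ≥ κ`. It is a subset of the space of nonempty
compact subsets of `ℝᴰ`, whose distance in Mathlib is the Hausdorff distance. -/
def manifoldClass {D : ℕ} (d : ℕ) (K : Set (EuclideanSpace ℝ (Fin D))) (κ : ℝ) :
    Set (TopologicalSpace.NonemptyCompacts (EuclideanSpace ℝ (Fin D))) :=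
  {M | (M : Set (EuclideanSpace ℝ (Fin D))) ⊆ K ∧
    IsSmoothSubmanifold d (M : Set (EuclideanSpace ℝ (Fin D))) ∧
    ENNReal.ofReal κ ≤ conditionNumber (M : Set (EuclideanSpace ℝ (Fin D)))}

/-!
The proof is a multi-scale coding argument, resting on a second-order description of manifolds of
reach at least `κ`.

*Geometry.* Let `T p` be the tangent space of `M` at `p` and `N_p` the orthogonal projection onto
its complement. Then, for all points of `M` and all tangent vectors, however large,
`‖N_p (q - p)‖ ≤ ‖q - p‖² / (2κ)`, and some point of `M` lies within `2‖v‖² / κ` of `p + v`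
(`IsTangentField`, `exists_isTangentField`).
The first estimate is Federer's: if `n` is a unit normal at `p`, then `p` is the nearest point of
`M` to `p + τ n` for small `τ`, because `M` is `C²`, and this persists for all `τ < κ`, because the
distance to `M` has slope one wherever nearest points are unique
(`infDist_add_smul_eq_of_unique`). The second follows from the first by comparison:
`u(t) = infDist (p + t v) M` satisfies `t u' ≤ u + 2 t² ‖v‖² / κ` and `u(t) = o(t)` at `0`
(`infDist_add_le_of_tangent`). Together they bound the angle between tangent spaces at nearby points
of two manifolds at small Hausdorff distance (`IsTangentField.norm_normal_le_of_near`), and, for a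
single manifold, show that a `δ`-separated subset has at most `C ^ D * (κ / δ) ^ d` points
(`IsTangentField.card_le_of_separated`).

*Coding.* Put `ε = δ² / κ` and fix `M₀` in the class. Near a point `x` of a `δ`-net of `M₀`, each
`M` with `dist M M₀ ≤ ε` lies in the slab about `x + T₀ x` of width of order `δ` and height of
order `ε`. The code of `M` records which cells of the slabs, small multiples of `δ` wide and of `ε`
high, it meets. Two members with the same code are at distance at most `ε / 2`: a point in the same
cell can be moved along the manifold by the difference of the horizontal components, with an error
quadratic in it. So the `ε`-ball about `M₀` has an `ε / 2`-cover with at most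
`exp (C ^ D * (κ / δ) ^ d)` members (`exists_cover_half_of_ball`). As `(κ / δ) ^ d` grows
geometrically when `ε` is halved, the exponents of the scales `κ / 2 ^ j`, `j ≤ k`, add up to a
multiple of the last one (`exists_cover_dyadic`), which is of the order `γ ^ (-d / 2)` for
`κ / 2 ^ k ≈ γ`. Constants to the power `D` are absorbed into `c₂`, and the first factor of the
bound is needed for `κ ≤ γ` only.
-/

open Metric Set Filter Topology Module

/-! ### The distance function where nearest points are unique -/

section Reach

variable {E : Type*} [NormedAddCommGroup E] [InnerProductSpace ℝ E]

/-- Where the nearest point is unique, the distance to `M` grows with slope one in some direction,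
namely the direction away from that nearest point. -/
lemma exists_infDist_slope {M : Set E} (hM : IsCompact M) {x q : E} (hq : q ∈ M)
    (hxq : dist x q = infDist x M) (hu : ∀ p ∈ M, dist x p = infDist x M → p = q)
    (hpos : 0 < infDist x M) {η : ℝ} (hη : 0 < η) :
    ∃ m : E, ‖m‖ = 1 ∧
      ∀ᶠ h : ℝ in 𝓝[>] 0, infDist x M + h * (1 - η) ≤ infDist (x + h • m) M := by
  set δ := infDist x M with hδ
  have hxq' : ‖x - q‖ = δ := by rw [← dist_eq_norm, hxq]
  set m : E := δ⁻¹ • (x - q) with hm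
  have hm1 : ‖m‖ = 1 := by
    rw [hm, norm_smul, hxq', norm_inv, Real.norm_of_nonneg hpos.le, inv_mul_cancel₀ hpos.ne']
  refine ⟨m, hm1, ?_⟩
  set g : E → ℝ := fun y => inner ℝ m (x - y) - (1 - η) * ‖x - y‖ with hg
  have hgc : Continuous g := by fun_prop
  have hgq : 0 < g q := by
    have : inner ℝ m (x - q) = δ := by
      rw [hm, real_inner_smul_left, real_inner_self_eq_norm_sq, hxq']; field_simp
    simp only [hg, this, hxq']
    nlinarith
  have hUo : IsOpen {y | 0 < g y} := isOpen_lt continuous_const hgc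
  obtain ⟨c, hc, hcM⟩ : ∃ c : ℝ, 0 < c ∧ ∀ p ∈ M, g p ≤ 0 → δ + c ≤ dist x p := by
    have hcomp : IsCompact (M \ {y | 0 < g y}) := hM.diff hUo
    rcases (M \ {y | 0 < g y}).eq_empty_or_nonempty with he | hne
    · refine ⟨1, one_pos, fun p hp hgp => ?_⟩
      have : p ∈ M \ {y | 0 < g y} := ⟨hp, by simpa using hgp⟩
      rw [he] at this
      exact this.elim
    · obtain ⟨p₀, hp₀, hmin⟩ := hcomp.exists_isMinOn hne
        (f := fun p => dist x p) (by fun_prop)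
      have hlt : δ < dist x p₀ := by
        refine lt_of_le_of_ne (infDist_le_dist_of_mem hp₀.1) fun h => hp₀.2 ?_
        rw [hu p₀ hp₀.1 h.symm]
        exact hgq
      refine ⟨dist x p₀ - δ, by linarith, fun p hp hgp => ?_⟩
      have : dist x p₀ ≤ dist x p :=
        hmin (show p ∈ M \ {y | 0 < g y} from ⟨hp, by simpa using hgp⟩)
      linarith
  have hsmall : ∀ᶠ h : ℝ in 𝓝[>] 0, h < c / 2 :=
    nhdsWithin_le_nhds (Iio_mem_nhds (by positivity))
  filter_upwards [hsmall, self_mem_nhdsWithin] with h hh hh0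
  have hh0 : 0 < h := hh0
  refine (le_infDist ⟨q, hq⟩).2 fun p hp => ?_
  rcases le_or_gt (g p) 0 with hgp | hgp
  · have h1 := hcM p hp hgp
    have h2 : dist x p ≤ dist (x + h • m) p + h := by
      have : dist x (x + h • m) = h := by
        rw [dist_eq_norm]
        simp [norm_smul, hm1, abs_of_pos hh0]
      calc dist x p ≤ dist x (x + h • m) + dist (x + h • m) p := dist_triangle _ _ _
        _ = _ := by rw [this, add_comm]
    nlinarith
  · have h1 : δ ≤ ‖x - p‖ := by rw [← dist_eq_norm]; exact infDist_le_dist_of_mem hp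
    have h0 : 0 < ‖x - p‖ := hpos.trans_le h1
    -- convexity of the norm: compare with its supporting functional in the direction `x - p`
    have h2 : inner ℝ (x + h • m - p) (x - p) ≤ ‖x + h • m - p‖ * ‖x - p‖ :=
      real_inner_le_norm _ _
    have h3 : inner ℝ (x + h • m - p) (x - p) = ‖x - p‖ ^ 2 + h * inner ℝ m (x - p) := by
      rw [show x + h • m - p = (x - p) + h • m by abel, inner_add_left,
        real_inner_self_eq_norm_sq, real_inner_smul_left]
    have h4 : (1 - η) * ‖x - p‖ < inner ℝ m (x - p) := by simpa [hg] using hgp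
    rw [dist_eq_norm]
    have h5 : (‖x - p‖ + h * (1 - η)) * ‖x - p‖ ≤ ‖x + h • m - p‖ * ‖x - p‖ := by
      nlinarith
    have := le_of_mul_le_mul_right h5 h0
    linarith

/-- Inside the region of unique nearest points, the distance to `M` attains on a closed ball of
radius `s` a value that exceeds the one at the centre by `s`. This replaces the gradient flow of the
distance: a maximiser of `infDist x M - (1 - η) * dist x x₀` has to lie on the sphere. -/
lemma exists_le_infDist_of_unique [ProperSpace E] {M : Set E} (hM : IsCompact M) {κ : ℝ}
    (hu : ∀ z, infDist z M < κ → ∃! p, p ∈ M ∧ dist z p = infDist z M)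
    {x₀ : E} (h0 : 0 < infDist x₀ M) {s : ℝ} (hs : 0 ≤ s) (hsκ : infDist x₀ M + s < κ) :
    ∃ x, dist x x₀ ≤ s ∧ infDist x₀ M + s ≤ infDist x M := by
  have hcb : IsCompact (closedBall x₀ s) := isCompact_closedBall _ _
  have hne : (closedBall x₀ s).Nonempty := ⟨x₀, mem_closedBall_self hs⟩
  obtain ⟨X, hX, hXmax⟩ := hcb.exists_isMaxOn hne (continuous_infDist_pt M).continuousOn
  refine ⟨X, hX, ?_⟩
  have key : ∀ η : ℝ, 0 < η → η < 1 → infDist x₀ M + (1 - η) * s ≤ infDist X M := by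
    intro η hη hη1
    obtain ⟨y, hy, hymax⟩ := hcb.exists_isMaxOn hne
      (f := fun x => infDist x M - (1 - η) * dist x x₀)
      (((continuous_infDist_pt M).sub (by fun_prop)).continuousOn)
    have hymax' : ∀ x ∈ closedBall x₀ s,
      infDist x M - (1 - η) * dist x x₀ ≤ infDist y M - (1 - η) * dist y x₀ := hymax
    have h1 := hymax' x₀ (mem_closedBall_self hs)
    rw [dist_self, mul_zero, sub_zero] at h1
    have hyd : dist y x₀ ≤ s := hy
    have hXy : infDist y M ≤ infDist X M := hXmax hy
    suffices hds : dist y x₀ = s by rw [hds] at h1; linarith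
    by_contra hds
    have hlt : dist y x₀ < s := lt_of_le_of_ne hyd hds
    have hypos : 0 < infDist y M := by
      have : 0 ≤ (1 - η) * dist y x₀ := mul_nonneg (by linarith) dist_nonneg
      linarith
    have hyκ : infDist y M < κ := by
      have := infDist_le_infDist_add_dist (s := M) (x := y) (y := x₀)
      linarith
    obtain ⟨q, ⟨hq, hyq⟩, huq⟩ := hu y hyκ
    obtain ⟨m, hm, hev⟩ := exists_infDist_slope hM hq hyq (fun p hp hd => huq p ⟨hp, hd⟩)
      hypos (half_pos hη)
    have hsmall : ∀ᶠ h : ℝ in 𝓝[>] 0, h < s - dist y x₀ :=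
      nhdsWithin_le_nhds (Iio_mem_nhds (by linarith))
    obtain ⟨h, hh, hhs, hh0⟩ := (hev.and (hsmall.and self_mem_nhdsWithin)).exists
    have hh0 : 0 < h := hh0
    have hd : dist (y + h • m) x₀ ≤ dist y x₀ + h := by
      have : dist (y + h • m) y = h := by
        rw [dist_eq_norm]; simp [norm_smul, hm, abs_of_pos hh0]
      have := dist_triangle (y + h • m) y x₀
      linarith
    have h2 := hymax' (y + h • m) (by rw [mem_closedBall]; linarith)
    nlinarith
  refine le_of_forall_pos_lt_add fun e he => ?_
  have h1 := key (min (1 / 2) (e / (2 * (s + 1)))) (by positivity)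
    (lt_of_le_of_lt (min_le_left _ _) (by norm_num))
  have h2 : min (1 / 2) (e / (2 * (s + 1))) * s ≤ e / 2 := by
    calc min (1 / 2) (e / (2 * (s + 1))) * s ≤ e / (2 * (s + 1)) * (s + 1) := by
          gcongr
          · exact min_le_right _ _
          · linarith
      _ = e / 2 := by field_simp
  linarith

/-- If `a` is a nearest point of `M` to `a + τ • n`, it remains one further out along the ray, as
long as nearest points are unique. -/
theorem infDist_add_smul_eq_of_unique [ProperSpace E] {M : Set E} (hM : IsCompact M) {κ : ℝ}
    (hu : ∀ z, infDist z M < κ → ∃! p, p ∈ M ∧ dist z p = infDist z M)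
    {a n : E} (ha : a ∈ M) (hn : ‖n‖ = 1) {τ t : ℝ} (hτ : 0 < τ)
    (h : infDist (a + τ • n) M = τ) (hτt : τ ≤ t) (ht : t < κ) :
    infDist (a + t • n) M = t := by
  obtain ⟨X, hX, hXd⟩ := exists_le_infDist_of_unique hM hu (x₀ := a + τ • n) (by rwa [h])
    (s := t - τ) (by linarith) (by rw [h]; linarith)
  rw [h] at hXd
  have hXa : t ≤ ‖X - a‖ := by
    rw [← dist_eq_norm]
    have := infDist_le_dist_of_mem (x := X) ha
    linarith
  set y := X - (a + τ • n) with hy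
  have hy1 : ‖y‖ ≤ t - τ := by rw [← dist_eq_norm]; exact hX
  have h1 : ‖y + τ • n‖ ^ 2 = ‖y‖ ^ 2 + 2 * (τ * inner ℝ y n) + τ ^ 2 := by
    rw [norm_add_sq_real, real_inner_smul_right, norm_smul, hn, mul_one, Real.norm_eq_abs, sq_abs]
  have h2 : y + τ • n = X - a := by rw [hy]; abel
  rw [h2] at h1
  have h3 : ‖y - (t - τ) • n‖ ^ 2 = ‖y‖ ^ 2 - 2 * ((t - τ) * inner ℝ y n) + (t - τ) ^ 2 := by
    rw [norm_sub_sq_real, real_inner_smul_right, norm_smul, hn, mul_one, Real.norm_eq_abs, sq_abs]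
  have h4 : t ^ 2 ≤ ‖X - a‖ ^ 2 := by gcongr; linarith
  have h6 : ‖y‖ ^ 2 ≤ (t - τ) ^ 2 := by gcongr
  have h5 : t - τ ≤ inner ℝ y n := by nlinarith
  have h7 : ‖y - (t - τ) • n‖ ^ 2 ≤ 0 := by nlinarith
  have h8 : y - (t - τ) • n = 0 := by
    rw [← norm_eq_zero]; exact pow_eq_zero_iff two_ne_zero |>.1 (le_antisymm h7 (by positivity))
  have h9 : X = a + t • n := by
    have := sub_eq_zero.1 h8
    rw [hy, sub_smul] at this
    have : X = (t • n - τ • n) + (a + τ • n) := by rw [← this]; abel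
    rw [this]; abel
  refine le_antisymm ?_ (by rw [← h9]; linarith)
  calc infDist (a + t • n) M ≤ dist (a + t • n) a := infDist_le_dist_of_mem ha
    _ = t := by rw [dist_eq_norm]; simp [norm_smul, hn, abs_of_nonneg (hτ.le.trans hτt)]

end Reach

/-! ### Tangent spaces of a smooth submanifold and the normal estimate -/

section Tangent

variable {E F : Type*} [NormedAddCommGroup E] [InnerProductSpace ℝ E]
  [NormedAddCommGroup F] [NormedSpace ℝ F]

/-- Federer's estimate. The local quadratic bound, with an arbitrary constant, only serves to start
the normal rays; the global bound then has the constant `1 / (2 * κ)` of the reach. -/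
lemma norm_orthogonal_sub_le_of_unique [ProperSpace E] {M : Set E} (hM : IsCompact M) {κ : ℝ}
    (hκ : 0 < κ) (hu : ∀ z, infDist z M < κ → ∃! p, p ∈ M ∧ dist z p = infDist z M)
    {a : E} (ha : a ∈ M) {T : Submodule ℝ E} [T.HasOrthogonalProjection] {C : ℝ}
    (hC : ∀ᶠ p in 𝓝[M] a, ‖Tᗮ.starProjection (p - a)‖ ≤ C * ‖p - a‖ ^ 2)
    {q : E} (hq : q ∈ M) :
    ‖Tᗮ.starProjection (q - a)‖ ≤ ‖q - a‖ ^ 2 / (2 * κ) := by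
  set u := Tᗮ.starProjection (q - a) with hudef
  rcases eq_or_ne u 0 with h0 | h0
  · rw [h0, norm_zero]; positivity
  have hupos : 0 < ‖u‖ := norm_pos_iff.2 h0
  set n : E := ‖u‖⁻¹ • u with hndef
  have hn : ‖n‖ = 1 := by
    rw [hndef, norm_smul, norm_inv, norm_norm, inv_mul_cancel₀ hupos.ne']
  have huT : u ∈ Tᗮ := Submodule.starProjection_apply_mem _ _
  have hnT : n ∈ Tᗮ := Submodule.smul_mem _ _ huT
  have hinner : ∀ x : E, inner ℝ n x = inner ℝ n (Tᗮ.starProjection x) := by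
    intro x
    have := Submodule.starProjection_inner_eq_zero (K := Tᗮ) x n hnT
    rw [inner_sub_left, sub_eq_zero, real_inner_comm, real_inner_comm n] at this
    exact this
  have hexp : ∀ (t : ℝ) (p : E), ‖a + t • n - p‖ ^ 2
      = t ^ 2 - 2 * (t * inner ℝ n (p - a)) + ‖p - a‖ ^ 2 := by
    intro t p
    rw [show a + t • n - p = t • n - (p - a) by abel, norm_sub_sq_real, real_inner_smul_left,
      norm_smul, hn, mul_one, Real.norm_eq_abs, sq_abs]
  -- for small `τ`, the point `a` is nearest to `a + τ • n`: the quadratic bound takes care of the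
  -- points of `M` near `a`, and the others are farther than `2 * τ` from `a`
  obtain ⟨τ, hτ0, hτκ, hτ⟩ : ∃ τ : ℝ, 0 < τ ∧ τ < κ ∧ infDist (a + τ • n) M = τ := by
    rw [eventually_nhdsWithin_iff, Metric.eventually_nhds_iff] at hC
    obtain ⟨ρ, hρ, hC⟩ := hC
    set τ := min (min (ρ / 2) (κ / 2)) (1 / (2 * (|C| + 1))) with hτdef
    have hC1 : 0 < |C| + 1 := by positivity
    have hτ0 : 0 < τ := by positivity
    have h1 : τ ≤ ρ / 2 := (min_le_left _ _).trans (min_le_left _ _)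
    have h2 : τ ≤ κ / 2 := (min_le_left _ _).trans (min_le_right _ _)
    have h3 : τ * (2 * (|C| + 1)) ≤ 1 := by
      rw [← le_div_iff₀ (by positivity)]; exact min_le_right _ _
    refine ⟨τ, hτ0, by linarith, le_antisymm ?_ ?_⟩
    · calc infDist (a + τ • n) M ≤ dist (a + τ • n) a := infDist_le_dist_of_mem ha
        _ = τ := by rw [dist_eq_norm]; simp [norm_smul, hn, abs_of_pos hτ0]
    · refine (le_infDist ⟨a, ha⟩).2 fun p hp => ?_
      rw [dist_eq_norm]
      refine le_of_sq_le_sq ?_ (norm_nonneg _)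
      rw [hexp]
      suffices 2 * (τ * inner ℝ n (p - a)) ≤ ‖p - a‖ ^ 2 by linarith
      rcases lt_or_ge ‖p - a‖ ρ with hlt | hge
      · have h4 := hC (show dist p a < ρ by rwa [dist_eq_norm]) hp
        have h5 : inner ℝ n (p - a) ≤ |C| * ‖p - a‖ ^ 2 := by
          rw [hinner]
          calc _ ≤ ‖n‖ * ‖Tᗮ.starProjection (p - a)‖ := real_inner_le_norm _ _
            _ ≤ C * ‖p - a‖ ^ 2 := by rw [hn, one_mul]; exact h4
            _ ≤ _ := by gcongr; exact le_abs_self C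
        have h6 : 0 ≤ ‖p - a‖ ^ 2 := by positivity
        calc 2 * (τ * inner ℝ n (p - a)) ≤ 2 * (τ * (|C| * ‖p - a‖ ^ 2)) := by gcongr
          _ ≤ (τ * (2 * (|C| + 1))) * ‖p - a‖ ^ 2 := by nlinarith [mul_nonneg hτ0.le h6]
          _ ≤ 1 * ‖p - a‖ ^ 2 := by gcongr
          _ = _ := one_mul _
      · have h5 : inner ℝ n (p - a) ≤ ‖p - a‖ := by
          simpa [hn] using real_inner_le_norm n (p - a)
        have h6 : 0 ≤ ‖p - a‖ := norm_nonneg _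
        nlinarith
  have hall : ∀ t : ℝ, τ ≤ t → t < κ → 2 * (t * ‖u‖) ≤ ‖q - a‖ ^ 2 := by
    intro t ht htκ
    have h1 := infDist_add_smul_eq_of_unique hM hu ha hn hτ0 hτ ht htκ
    have h2 : t ≤ ‖a + t • n - q‖ := by
      rw [← dist_eq_norm]
      conv_lhs => rw [← h1]
      exact infDist_le_dist_of_mem hq
    have h3 : t ^ 2 ≤ ‖a + t • n - q‖ ^ 2 := by
      gcongr
      linarith
    have h4 : inner ℝ n (q - a) = ‖u‖ := by
      rw [hinner, ← hudef, hndef, real_inner_smul_left, real_inner_self_eq_norm_sq]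
      field_simp
    rw [hexp, h4] at h3
    linarith
  rw [le_div_iff₀ (by positivity)]
  refine le_of_forall_lt_imp_le_of_dense fun c hc => ?_
  -- choose `t < κ` with `c < 2 * t * ‖u‖`
  have hlt : c / (2 * ‖u‖) < κ := by
    rw [div_lt_iff₀ (by positivity)]; linarith
  obtain ⟨t, ht1, ht2⟩ := exists_between (max_lt hlt hτκ)
  have := hall t ((le_max_right _ _).trans ht1.le) ht2
  have h5 : c / (2 * ‖u‖) < t := (le_max_left _ _).trans_lt ht1
  rw [div_lt_iff₀ (by positivity)] at h5
  linarith

lemma ContDiffAt.exists_norm_sub_fderiv_le {G : Type*} [NormedAddCommGroup G] [NormedSpace ℝ G]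
    {f : F → G} {x : F} (hf : ContDiffAt ℝ 2 f x) :
    ∃ C, 0 ≤ C ∧ ∀ᶠ y in 𝓝 x, ‖f y - f x - fderiv ℝ f x (y - x)‖ ≤ C * ‖y - x‖ ^ 2 := by
  have h1 : ContDiffAt ℝ 1 (fderiv ℝ f) x := hf.fderiv_right (by norm_num)
  obtain ⟨K, t, ht, hK⟩ := h1.exists_lipschitzOnWith
  have hd : ∀ᶠ y in 𝓝 x, DifferentiableAt ℝ f y :=
    (hf.eventually (by simp)).mono fun y hy => hy.differentiableAt (by norm_num)
  obtain ⟨ρ, hρ, hball⟩ := Metric.mem_nhds_iff.1 (Filter.inter_mem ht hd)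
  refine ⟨K, K.2, Metric.eventually_nhds_iff.2 ⟨ρ, hρ, fun y hy => ?_⟩⟩
  have hyx : ‖y - x‖ < ρ := by rwa [← dist_eq_norm]
  have hsub : closedBall x ‖y - x‖ ⊆ ball x ρ := closedBall_subset_ball hyx
  have hxb : x ∈ closedBall x ‖y - x‖ := mem_closedBall_self (norm_nonneg _)
  have := (convex_closedBall x ‖y - x‖).norm_image_sub_le_of_norm_fderiv_le' (𝕜 := ℝ) (f := f)
    (φ := fderiv ℝ f x) (C := K * ‖y - x‖) (x := x) (y := y)
    (fun z hz => (hball (hsub hz)).2)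
    (fun z hz => by
      rw [← dist_eq_norm]
      refine (hK.dist_le_mul z (hball (hsub hz)).1 x (hball (hsub hxb)).1).trans ?_
      gcongr
      exact hz)
    hxb (by rw [mem_closedBall, dist_eq_norm])
  rw [sq, ← mul_assoc]
  exact this

/-- The tangent space of a smooth submanifold at a point: `M` leaves it quadratically, and each of
its vectors is the velocity of a path in `M`. It is the image of the first `d` coordinates under the
derivative of the inverse slice chart. -/
theorem IsSmoothSubmanifold.exists_tangent {D d : ℕ} {M : Set (EuclideanSpace ℝ (Fin D))}
    (hM : IsSmoothSubmanifold d M) {a : EuclideanSpace ℝ (Fin D)} (ha : a ∈ M) :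
    ∃ T : Submodule ℝ (EuclideanSpace ℝ (Fin D)), finrank ℝ T ≤ d ∧
      (∃ C : ℝ, ∀ᶠ q in 𝓝[M] a, ‖Tᗮ.starProjection (q - a)‖ ≤ C * ‖q - a‖ ^ 2) ∧
      ∀ w ∈ T, ∀ η : ℝ, 0 < η → ∀ᶠ h : ℝ in 𝓝[>] 0, infDist (a + h • w) M ≤ h * η := by
  obtain ⟨φ, haφ, hφ, hψ, hmem⟩ := hM a ha
  have hat : φ a ∈ φ.target := φ.map_source haφ
  have hφa : ContDiffAt ℝ 1 φ a :=
    (hφ.contDiffAt (φ.open_source.mem_nhds haφ)).of_le (by exact_mod_cast le_top)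
  have hψa : ContDiffAt ℝ 2 φ.symm (φ a) :=
    (hψ.contDiffAt (φ.open_target.mem_nhds hat)).of_le (WithTop.coe_le_coe.2 (le_top : (2 : ℕ∞) ≤ ⊤))
  let S : Submodule ℝ (EuclideanSpace ℝ (Fin D)) :=
    { carrier := {y | ∀ i : Fin D, d ≤ (i : ℕ) → y i = 0}
      add_mem' := fun {x y} hx hy i hi => by simp [hx i hi, hy i hi]
      zero_mem' := fun i _ => by simp
      smul_mem' := fun c x hx i hi => by simp [hx i hi] }
  have hS : ∀ y, y ∈ S ↔ ∀ i : Fin D, d ≤ (i : ℕ) → y i = 0 := fun y => Iff.rfl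
  have hSd : finrank ℝ S ≤ d := by
    let r : S →ₗ[ℝ] (Fin d → ℝ) :=
      { toFun := fun y j => if hj : (j : ℕ) < D then y.1 ⟨j, hj⟩ else 0
        map_add' := fun x y => by
          ext j
          by_cases hj : (j : ℕ) < D <;> simp [hj]
        map_smul' := fun c x => by
          ext j
          by_cases hj : (j : ℕ) < D <;> simp [hj] }
    have hr : Function.Injective r := by
      rw [← LinearMap.ker_eq_bot, LinearMap.ker_eq_bot']
      intro y hy
      ext i
      rcases lt_or_ge (i : ℕ) d with hi | hi
      · simpa [r] using congrFun hy ⟨i, hi⟩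
      · simpa using y.2 i hi
    simpa using LinearMap.finrank_le_finrank_of_injective hr
  have hφaS : φ a ∈ S := (hmem a haφ).1 ha
  set ψ' := fderiv ℝ φ.symm (φ a) with hψ'
  set T : Submodule ℝ (EuclideanSpace ℝ (Fin D)) := S.map ψ'.toLinearMap with hT
  refine ⟨T, (Submodule.finrank_map_le _ _).trans hSd, ?_, ?_⟩
  · obtain ⟨K, t, ht, hK⟩ := hφa.exists_lipschitzOnWith
    obtain ⟨C, hC0, hC⟩ := hψa.exists_norm_sub_fderiv_le
    refine ⟨C * K ^ 2, ?_⟩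
    have hev : ∀ᶠ q in 𝓝[M] a, q ∈ t ∧ q ∈ φ.source ∧
        ‖φ.symm (φ q) - φ.symm (φ a) - ψ' (φ q - φ a)‖ ≤ C * ‖φ q - φ a‖ ^ 2 :=
      nhdsWithin_le_nhds (Filter.inter_mem ht (Filter.inter_mem (φ.open_source.mem_nhds haφ)
        ((φ.continuousAt haφ).eventually hC)))
    filter_upwards [hev, self_mem_nhdsWithin] with q ⟨hqt, hqφ, hq⟩ hqM
    rw [φ.left_inv hqφ, φ.left_inv haφ] at hq
    have hqS : φ q - φ a ∈ S := S.sub_mem ((hmem q hqφ).1 hqM) hφaS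
    have hqT : ψ' (φ q - φ a) ∈ T := Submodule.mem_map_of_mem hqS
    have h0 : Tᗮ.starProjection (ψ' (φ q - φ a)) = 0 :=
      Submodule.starProjection_orthogonal_apply_eq_zero hqT
    have hL : ‖φ q - φ a‖ ≤ K * ‖q - a‖ := by
      simpa [dist_eq_norm] using hK.dist_le_mul q hqt a (mem_of_mem_nhds ht)
    calc ‖Tᗮ.starProjection (q - a)‖ = ‖Tᗮ.starProjection (q - a - ψ' (φ q - φ a))‖ := by
          rw [map_sub _ (q - a), h0, sub_zero]
      _ ≤ ‖q - a - ψ' (φ q - φ a)‖ := Submodule.norm_starProjection_apply_le _ _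
      _ ≤ C * ‖φ q - φ a‖ ^ 2 := hq
      _ ≤ C * (K * ‖q - a‖) ^ 2 := by gcongr
      _ = _ := by ring
  · rintro _ ⟨s, hs, rfl⟩ η hη
    have hd : HasFDerivAt φ.symm ψ' (φ a) := (hψa.differentiableAt (by norm_num)).hasFDerivAt
    have hline : HasDerivAt (fun h : ℝ => φ.symm (φ a + h • s)) (ψ' s) 0 := by
      have h1 : HasDerivAt (fun h : ℝ => φ a + h • s) s 0 := by
        simpa using ((hasDerivAt_id (0 : ℝ)).smul_const s).const_add (φ a)
      refine HasFDerivAt.comp_hasDerivAt (0 : ℝ) ?_ h1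
      simpa using hd
    have hlit := (hasDerivAt_iff_isLittleO_nhds_zero.1 hline).def hη
    have htar : ∀ᶠ h : ℝ in 𝓝 0, φ a + h • s ∈ φ.target := by
      have hc : ContinuousAt (fun h : ℝ => φ a + h • s) 0 := by fun_prop
      exact hc.eventually_mem (φ.open_target.mem_nhds (by simpa using hat))
    filter_upwards [nhdsWithin_le_nhds hlit, nhdsWithin_le_nhds htar, self_mem_nhdsWithin]
      with h hh hht hh0
    have hh0 : 0 < h := hh0
    have hin : φ.symm (φ a + h • s) ∈ M := by
      rw [hmem _ (φ.map_target hht), φ.right_inv hht]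
      exact S.add_mem hφaS (S.smul_mem h hs)
    simp only [zero_add, zero_smul, add_zero, φ.left_inv haφ, Real.norm_of_nonneg hh0.le] at hh
    calc infDist (a + h • ψ' s) M ≤ dist (a + h • ψ' s) (φ.symm (φ a + h • s)) :=
          infDist_le_dist_of_mem hin
      _ = ‖φ.symm (φ a + h • s) - a - h • ψ' s‖ := by
          rw [dist_comm, dist_eq_norm]; congr 1; abel
      _ ≤ η * h := hh
      _ = _ := mul_comm _ _

end Tangent

/-! ### The two-sided second-order estimate -/

section TangentField

variable {E : Type*} [NormedAddCommGroup E] [InnerProductSpace ℝ E] [FiniteDimensional ℝ E]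

/-- A field of subspaces of dimension at most `d` along `M` to which `M` is tangent to second order
at the scale `κ`, uniformly and in both directions: the points of `M` lie quadratically close to
the affine subspaces `p + T p`, and the points of these affine subspaces lie quadratically
close to `M`. No smallness of the displacement is asked for in either estimate. -/
structure IsTangentField (κ : ℝ) (d : ℕ) (M : Set E) (T : E → Submodule ℝ E) : Prop where
  finrank_le : ∀ p ∈ M, finrank ℝ (T p) ≤ d
  norm_normal_le : ∀ p ∈ M, ∀ q ∈ M, ‖(T p)ᗮ.starProjection (q - p)‖ ≤ ‖q - p‖ ^ 2 / (2 * κ)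
  exists_near : ∀ p ∈ M, ∀ v ∈ T p, ∃ q ∈ M, ‖q - (p + v)‖ ≤ 2 * ‖v‖ ^ 2 / κ

lemma starProjection_add_orthogonal (T : Submodule ℝ E) (x : E) :
    T.starProjection x + Tᗮ.starProjection x = x := by
  simp [Submodule.starProjection_orthogonal']

/-- The displacement `v` need not be small: `t ↦ infDist (p + t • v) M` is compared on the whole of
`[0, 1]` with a solution of `t * u' = u + 2 * t ^ 2 * ‖v‖ ^ 2 / κ`. -/
lemma infDist_add_le_of_tangent {M : Set E} (hM : IsCompact M) {κ : ℝ} (hκ : 0 < κ)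
    {T : E → Submodule ℝ E}
    (hN : ∀ p ∈ M, ∀ q ∈ M, ‖(T p)ᗮ.starProjection (q - p)‖ ≤ ‖q - p‖ ^ 2 / (2 * κ))
    (hT : ∀ p ∈ M, ∀ w ∈ T p, ∀ η : ℝ, 0 < η →
      ∀ᶠ h : ℝ in 𝓝[>] 0, infDist (p + h • w) M ≤ h * η)
    {p v : E} (hp : p ∈ M) (hv : v ∈ T p) :
    infDist (p + v) M ≤ 2 * ‖v‖ ^ 2 / κ := by
  set V := ‖v‖ ^ 2 / κ with hV
  have hV0 : 0 ≤ V := by positivity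
  rw [mul_div_assoc, ← hV]
  set f : ℝ → ℝ := fun t => infDist (p + t • v) M with hf
  have hfc : Continuous f := (continuous_infDist_pt M).comp (by fun_prop)
  have hfle : ∀ t, 0 ≤ t → f t ≤ t * ‖v‖ := by
    intro t ht
    calc f t ≤ dist (p + t • v) p := infDist_le_dist_of_mem hp
      _ = t * ‖v‖ := by rw [dist_eq_norm]; simp [norm_smul, abs_of_nonneg ht]
  -- the right lower Dini derivative of `f`
  have hslope : ∀ t : ℝ, 0 < t → ∀ r, (f t + 2 * t ^ 2 * V) / t < r →
      ∃ᶠ z in 𝓝[>] t, slope f t z < r := by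
    intro t ht r hr
    obtain ⟨q, hq, hzq⟩ := hM.exists_infDist_eq_dist ⟨p, hp⟩ (p + t • v)
    set P := (T q).starProjection v
    set N := (T q)ᗮ.starProjection v with hNdef
    have hPN : P + N = v := starProjection_add_orthogonal _ _
    have hqp : ‖q - p‖ ≤ 2 * (t * ‖v‖) := by
      have h1 : ‖q - p‖ ≤ dist (p + t • v) q + ‖t • v‖ := by
        rw [dist_comm, dist_eq_norm]
        calc ‖q - p‖ = ‖(q - (p + t • v)) + t • v‖ := by congr 1; abel
          _ ≤ _ := norm_add_le _ _
      rw [← hzq, norm_smul, Real.norm_of_nonneg ht.le] at h1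
      have := hfle t ht.le
      simp only [hf] at this
      linarith
    have htN : t * ‖N‖ ≤ f t + 2 * t ^ 2 * V := by
      have h1 : t • N = (T q)ᗮ.starProjection (p + t • v - q)
          - (T q)ᗮ.starProjection (p - q) := by
        rw [← map_sub, hNdef, ← map_smul]; congr 1; abel
      have h2 : ‖(T q)ᗮ.starProjection (p + t • v - q)‖ ≤ f t := by
        refine (Submodule.norm_starProjection_apply_le _ _).trans ?_
        rw [← dist_eq_norm, ← hzq]
      have h3 : ‖(T q)ᗮ.starProjection (p - q)‖ ≤ 2 * t ^ 2 * V := by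
        refine (hN q hq p hp).trans ?_
        rw [norm_sub_rev, hV, div_le_iff₀ (by positivity)]
        have : ‖q - p‖ ^ 2 ≤ (2 * (t * ‖v‖)) ^ 2 := by gcongr
        have h4 : 2 * t ^ 2 * (‖v‖ ^ 2 / κ) * (2 * κ) = (2 * (t * ‖v‖)) ^ 2 := by
          field_simp
        linarith
      calc t * ‖N‖ = ‖t • N‖ := by rw [norm_smul, Real.norm_of_nonneg ht.le]
        _ ≤ _ := by rw [h1]; exact (norm_sub_le _ _).trans (add_le_add h2 h3)
    have hNr : ‖N‖ < r := by
      refine lt_of_le_of_lt ?_ hr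
      rw [le_div_iff₀ ht]; linarith
    have hev := hT q hq P (Submodule.starProjection_apply_mem _ _) ((r - ‖N‖) / 2)
      (by linarith)
    have hmap : Tendsto (fun z : ℝ => z - t) (𝓝[>] t) (𝓝[>] 0) := by
      refine tendsto_nhdsWithin_iff.2 ⟨?_, ?_⟩
      · have : Tendsto (fun z : ℝ => z - t) (𝓝 t) (𝓝 (t - t)) :=
          (continuous_id.sub continuous_const).tendsto t
        rw [sub_self] at this
        exact this.mono_left nhdsWithin_le_nhds
      · filter_upwards [self_mem_nhdsWithin] with z hz
        exact sub_pos.2 (show t < z from hz)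
    refine Eventually.frequently ?_
    filter_upwards [hmap.eventually hev, self_mem_nhdsWithin] with z hz hzt
    have hh : 0 < z - t := sub_pos.2 hzt
    set h := z - t with hhdef
    have hz' : z = t + h := by rw [hhdef]; ring
    rw [slope_def_field, div_lt_iff₀ hh]
    have h1 : f z ≤ infDist (q + h • P) M + dist (p + z • v) (q + h • P) :=
      infDist_le_infDist_add_dist
    have h2 : dist (p + z • v) (q + h • P) ≤ f t + h * ‖N‖ := by
      have : p + z • v - (q + h • P) = (p + t • v - q) + h • N := by
        rw [hz', ← hPN]
        module
      rw [dist_eq_norm, this]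
      refine (norm_add_le _ _).trans (add_le_add ?_ ?_)
      · rw [← dist_eq_norm, ← hzq]
      · rw [norm_smul, Real.norm_of_nonneg hh.le]
    nlinarith
  have hcmp : ∀ η : ℝ, 0 < η → f 1 ≤ 2 * V + 2 * η := by
    intro η hη
    have hsmall : ∀ᶠ a : ℝ in 𝓝[>] 0, a < 1 := nhdsWithin_le_nhds (Iio_mem_nhds one_pos)
    have hpos : ∀ᶠ a : ℝ in 𝓝[>] 0, 0 < a := self_mem_nhdsWithin
    obtain ⟨a, ha, ha0, ha1⟩ := ((hT p hp v hv η hη).and (hpos.and hsmall)).exists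
    have := image_le_of_liminf_slope_right_lt_deriv_boundary (f := f)
      (f' := fun t => (f t + 2 * t ^ 2 * V) / t) (a := a) (b := 1)
      (B := fun t => (2 * V + η) * t ^ 2 + η * t) (B' := fun t => (2 * V + η) * (2 * t) + η)
      hfc.continuousOn (fun x hx r hr => hslope x (ha0.trans_le hx.1) r hr)
      (by simp only [hf]; nlinarith [mul_nonneg hV0 (sq_nonneg a), mul_pos hη (pow_pos ha0 2)])
      (fun x => by
        have h1 := ((hasDerivAt_pow 2 x).const_mul (2 * V + η)).add
          ((hasDerivAt_id x).const_mul η)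
        refine h1.congr_deriv ?_
        simp)
      (fun x hx hfx => by
        have hx0 : 0 < x := ha0.trans_le hx.1
        simp only [hfx]
        rw [div_lt_iff₀ hx0]
        nlinarith [mul_pos hη (pow_pos hx0 2)])
      (show (1 : ℝ) ∈ Icc a 1 from ⟨ha1.le, le_rfl⟩)
    linarith
  have h1 : f 1 ≤ 2 * V := by
    refine le_of_forall_pos_lt_add fun e he => ?_
    have := hcmp (e / 4) (by positivity)
    linarith
  simpa [hf] using h1

theorem IsTangentField.of_local {M : Set E} (hM : IsCompact M) {κ : ℝ} (hκ : 0 < κ)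
    (hu : ∀ z, infDist z M < κ → ∃! p, p ∈ M ∧ dist z p = infDist z M)
    {d : ℕ} {T : E → Submodule ℝ E} (hd : ∀ p ∈ M, finrank ℝ (T p) ≤ d)
    (hC : ∀ p ∈ M, ∃ C : ℝ, ∀ᶠ q in 𝓝[M] p, ‖(T p)ᗮ.starProjection (q - p)‖ ≤ C * ‖q - p‖ ^ 2)
    (hT : ∀ p ∈ M, ∀ w ∈ T p, ∀ η : ℝ, 0 < η →
      ∀ᶠ h : ℝ in 𝓝[>] 0, infDist (p + h • w) M ≤ h * η) :
    IsTangentField κ d M T := by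
  have hN : ∀ p ∈ M, ∀ q ∈ M, ‖(T p)ᗮ.starProjection (q - p)‖ ≤ ‖q - p‖ ^ 2 / (2 * κ) := by
    intro p hp q hq
    obtain ⟨C, hC⟩ := hC p hp
    exact norm_orthogonal_sub_le_of_unique hM hκ hu hp hC hq
  refine ⟨hd, hN, fun p hp v hv => ?_⟩
  obtain ⟨q, hq, hzq⟩ := hM.exists_infDist_eq_dist ⟨p, hp⟩ (p + v)
  refine ⟨q, hq, ?_⟩
  rw [← dist_eq_norm, dist_comm, ← hzq]
  exact infDist_add_le_of_tangent hM hκ hN hT hp hv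

lemma exists_unique_nearest_of_le_conditionNumber {D : ℕ} {M : Set (EuclideanSpace ℝ (Fin D))}
    (hne : M.Nonempty) {κ : ℝ} (h : ENNReal.ofReal κ ≤ conditionNumber M)
    (z : EuclideanSpace ℝ (Fin D)) (hz : infDist z M < κ) :
    ∃! p, p ∈ M ∧ dist z p = infDist z M := by
  have h1 : ENNReal.ofReal (infDist z M) < conditionNumber M :=
    ((ENNReal.ofReal_lt_ofReal_iff_of_nonneg infDist_nonneg).2 hz).trans_le h
  unfold conditionNumber at h1
  obtain ⟨r, hr⟩ := lt_iSup_iff.1 h1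
  obtain ⟨hr1, hr2⟩ := lt_iSup_iff.1 hr
  refine hr1 z ((mem_thickening_iff_infDist_lt hne).2 ?_)
  rwa [ENNReal.ofReal_lt_coe_iff infDist_nonneg] at hr2

theorem exists_isTangentField {D d : ℕ} {K : Set (EuclideanSpace ℝ (Fin D))} {κ : ℝ} (hκ : 0 < κ)
    {M : TopologicalSpace.NonemptyCompacts (EuclideanSpace ℝ (Fin D))}
    (hM : M ∈ manifoldClass d K κ) :
    ∃ T, IsTangentField κ d (M : Set (EuclideanSpace ℝ (Fin D))) T := by
  classical
  have h : ∀ p : EuclideanSpace ℝ (Fin D),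
      ∃ T : Submodule ℝ (EuclideanSpace ℝ (Fin D)), p ∈ (M : Set _) → finrank ℝ T ≤ d ∧
      (∃ C : ℝ, ∀ᶠ q in 𝓝[(M : Set _)] p, ‖Tᗮ.starProjection (q - p)‖ ≤ C * ‖q - p‖ ^ 2) ∧
      ∀ w ∈ T, ∀ η : ℝ, 0 < η → ∀ᶠ h : ℝ in 𝓝[>] 0, infDist (p + h • w) (M : Set _) ≤ h * η := by
    intro p
    by_cases hp : p ∈ (M : Set (EuclideanSpace ℝ (Fin D)))
    · obtain ⟨T, hT⟩ := hM.2.1.exists_tangent hp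
      exact ⟨T, fun _ => hT⟩
    · exact ⟨⊥, fun h => absurd h hp⟩
  choose T hT using h
  exact ⟨T, .of_local M.isCompact hκ
    (exists_unique_nearest_of_le_conditionNumber M.nonempty hM.2.2)
    (fun p hp => (hT p hp).1) (fun p hp => (hT p hp).2.1) (fun p hp => (hT p hp).2.2)⟩

end TangentField

/-! ### Cardinality of separated sets -/

section Separated

open MeasureTheory in
/-- Volume comparison: the balls of radius `r / 2` about the points are disjoint. -/
lemma card_le_of_pairwise_le_dist {F : Type*} [NormedAddCommGroup F] [NormedSpace ℝ F]
    [FiniteDimensional ℝ F] {s : Finset F} {x : F} {R r : ℝ} (hr : 0 < r) (hR : 0 ≤ R)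
    (hs : ∀ y ∈ s, dist y x ≤ R) (hsep : ∀ y ∈ s, ∀ z ∈ s, y ≠ z → r ≤ dist y z) :
    (s.card : ℝ) ≤ (2 * R / r + 1) ^ finrank ℝ F := by
  borelize F
  let μ : Measure F := Measure.addHaar
  set δ : ℝ := r / 2 with hδ
  have δpos : 0 < δ := by positivity
  set ρ : ℝ := R + r / 2 with hρ
  have ρpos : 0 < ρ := by positivity
  have hdisj : Set.Pairwise (s : Set F) (Function.onFun Disjoint fun c => ball (c : F) δ) := by
    rintro c hc e he hce
    refine ball_disjoint_ball ?_
    have := hsep c hc e he hce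
    linarith
  have hsub : (⋃ c ∈ s, ball (c : F) δ) ⊆ ball x ρ := by
    refine iUnion₂_subset fun c hc => ball_subset_ball' ?_
    have := hs c hc
    linarith
  have I : (s.card : ℝ≥0∞) * ENNReal.ofReal (δ ^ finrank ℝ F) * μ (ball 0 1) ≤
      ENNReal.ofReal (ρ ^ finrank ℝ F) * μ (ball 0 1) :=
    calc
      _ = μ (⋃ c ∈ s, ball (c : F) δ) := by
        rw [measure_biUnion_finset hdisj fun c _ => measurableSet_ball]
        simp only [μ.addHaar_ball_of_pos _ δpos]
        simp only [Finset.sum_const, nsmul_eq_mul, mul_assoc]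
      _ ≤ μ (ball x ρ) := measure_mono hsub
      _ = _ := by rw [μ.addHaar_ball_of_pos _ ρpos]
  have J : (s.card : ℝ≥0∞) * ENNReal.ofReal (δ ^ finrank ℝ F) ≤
      ENNReal.ofReal (ρ ^ finrank ℝ F) :=
    (ENNReal.mul_le_mul_iff_left (measure_ball_pos _ _ zero_lt_one).ne' measure_ball_lt_top.ne).1 I
  have K : (s.card : ℝ) * δ ^ finrank ℝ F ≤ ρ ^ finrank ℝ F := by
    have := ENNReal.toReal_le_of_le_ofReal (pow_nonneg ρpos.le _) J
    simpa [ENNReal.toReal_mul, ENNReal.toReal_ofReal (pow_nonneg δpos.le _)] using this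
  have h1 : 2 * R / r + 1 = ρ / δ := by rw [hρ, hδ]; field_simp
  rw [h1, div_pow, le_div_iff₀ (by positivity)]
  exact K

/-- A maximal `r`-separated set is an `r`-net; it exists if `r`-separated sets have bounded size. -/
lemma exists_finset_net {X : Type*} [PseudoMetricSpace X] {A : Set X} {r : ℝ} (hr : 0 < r)
    {N : ℝ} (hN : ∀ s : Finset X, (s : Set X) ⊆ A →
      (∀ y ∈ s, ∀ z ∈ s, y ≠ z → r ≤ dist y z) → (s.card : ℝ) ≤ N) :
    ∃ s : Finset X, (s : Set X) ⊆ A ∧ (s.card : ℝ) ≤ N ∧ ∀ y ∈ A, ∃ x ∈ s, dist y x ≤ r := by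
  classical
  let good : Finset X → Prop := fun s =>
    (s : Set X) ⊆ A ∧ ∀ y ∈ s, ∀ z ∈ s, y ≠ z → r ≤ dist y z
  let Q : ℕ → Prop := fun n => ∃ s : Finset X, good s ∧ s.card = n
  have hQ0 : Q 0 := ⟨∅, ⟨by simp, by simp⟩, rfl⟩
  have hb : ∀ n, Q n → n ≤ ⌊N⌋₊ := by
    rintro n ⟨s, ⟨hs1, hs2⟩, rfl⟩
    exact Nat.le_floor (hN s hs1 hs2)
  have hmax : Q (Nat.findGreatest Q ⌊N⌋₊) := Nat.findGreatest_spec (Nat.zero_le _) hQ0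
  obtain ⟨s, ⟨hs1, hs2⟩, hcard⟩ := hmax
  refine ⟨s, hs1, hN s hs1 hs2, fun y hy => ?_⟩
  by_contra! hcon
  have hys : y ∉ s := fun h => by
    have := hcon y h
    rw [dist_self] at this
    linarith
  have hQ : Q (s.card + 1) := by
    refine ⟨insert y s, ⟨?_, ?_⟩, Finset.card_insert_of_notMem hys⟩
    · rw [Finset.coe_insert]
      exact insert_subset hy hs1
    · intro a ha b hb hab
      rw [Finset.mem_insert] at ha hb
      rcases ha with rfl | ha <;> rcases hb with rfl | hb
      · exact absurd rfl hab
      · exact (hcon b hb).le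
      · rw [dist_comm]; exact (hcon a ha).le
      · exact hs2 a ha b hb hab
  have := Nat.le_findGreatest (hb _ hQ) hQ
  omega

lemma exists_finset_net_of_subset_closedBall {F : Type*} [NormedAddCommGroup F] [NormedSpace ℝ F]
    [FiniteDimensional ℝ F] {A : Set F} {x : F} {R r : ℝ} (hr : 0 < r) (hR : 0 ≤ R)
    (hA : A ⊆ closedBall x R) :
    ∃ s : Finset F, (s : Set F) ⊆ A ∧ (s.card : ℝ) ≤ (2 * R / r + 1) ^ finrank ℝ F ∧
      ∀ y ∈ A, ∃ z ∈ s, dist y z ≤ r :=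
  exists_finset_net hr fun _ hs hsep =>
    card_le_of_pairwise_le_dist hr hR (fun _ hy => hA (hs hy)) hsep

end Separated

/-! ### Angles between tangent spaces, and separated subsets of manifolds -/

section Angle

variable {E : Type*} [NormedAddCommGroup E] [InnerProductSpace ℝ E] [FiniteDimensional ℝ E]

namespace IsTangentField

variable {κ : ℝ} {d : ℕ} {M M₁ M₂ : Set E} {T T₁ T₂ : E → Submodule ℝ E}

/-- A tangent vector `v` of `M₁` at `p` is nearly tangent to `M₂` at a nearby point `q`, if `M₁` lies
close to `M₂`: follow `v` along `M₁`, pass to `M₂`, and compare with `q`. -/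
lemma norm_normal_le_of_near (hκ : 0 < κ) (h₁ : IsTangentField κ d M₁ T₁)
    (h₂ : IsTangentField κ d M₂ T₂) {ε s t : ℝ}
    (hM : ∀ p ∈ M₁, ∃ q ∈ M₂, dist p q ≤ ε) {p q v : E} (hp : p ∈ M₁) (hq : q ∈ M₂)
    (hpq : dist p q ≤ s) (hv : v ∈ T₁ p) (hvt : ‖v‖ ≤ t) :
    ‖(T₂ q)ᗮ.starProjection v‖ ≤ 2 * ε + 2 * t ^ 2 / κ +
      ((s + ε) ^ 2 + (ε + 2 * t ^ 2 / κ + t + s) ^ 2) / (2 * κ) := by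
  obtain ⟨p', hp', hp'v⟩ := h₁.exists_near p hp v hv
  have hp'v : ‖p' - (p + v)‖ ≤ 2 * t ^ 2 / κ := hp'v.trans (by gcongr)
  obtain ⟨q', hq', hpq'⟩ := hM p' hp'
  obtain ⟨p₀, hp₀, hpp₀⟩ := hM p hp
  rw [dist_eq_norm] at hpq hpq' hpp₀
  set N := (T₂ q)ᗮ.starProjection with hN
  have hle : ∀ x, ‖N x‖ ≤ ‖x‖ := fun x => Submodule.norm_starProjection_apply_le _ _
  have e1 : ‖N (q' - q)‖ ≤ (ε + 2 * t ^ 2 / κ + t + s) ^ 2 / (2 * κ) := by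
    refine (h₂.norm_normal_le q hq q' hq').trans ?_
    gcongr
    calc ‖q' - q‖ = ‖-(p' - q') + (p' - (p + v)) + v + (p - q)‖ := by congr 1; abel
      _ ≤ ‖-(p' - q')‖ + ‖p' - (p + v)‖ + ‖v‖ + ‖p - q‖ := norm_add₄_le
      _ ≤ _ := by rw [norm_neg]; gcongr
  have e2 : ‖N (p₀ - q)‖ ≤ (s + ε) ^ 2 / (2 * κ) := by
    refine (h₂.norm_normal_le q hq p₀ hp₀).trans ?_
    gcongr
    calc ‖p₀ - q‖ = ‖(p - q) - (p - p₀)‖ := by congr 1; abel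
      _ ≤ ‖p - q‖ + ‖p - p₀‖ := norm_sub_le _ _
      _ ≤ _ := by gcongr
  have hdecomp : v = ((p' - q') - (p' - (p + v))) + (q' - q) - ((p - p₀) + (p₀ - q)) := by abel
  calc ‖N v‖ = ‖(N (p' - q') - N (p' - (p + v))) + N (q' - q) - (N (p - p₀) + N (p₀ - q))‖ := by
        conv_lhs => rw [hdecomp]
        simp only [map_add, map_sub]
    _ ≤ (‖N (p' - q')‖ + ‖N (p' - (p + v))‖) + ‖N (q' - q)‖ + (‖N (p - p₀)‖ + ‖N (p₀ - q)‖) := by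
        refine (norm_sub_le _ _).trans (add_le_add ((norm_add_le _ _).trans ?_) (norm_add_le _ _))
        gcongr
        exact norm_sub_le _ _
    _ ≤ (ε + 2 * t ^ 2 / κ) + (ε + 2 * t ^ 2 / κ + t + s) ^ 2 / (2 * κ)
          + (ε + (s + ε) ^ 2 / (2 * κ)) := by
        gcongr
        · exact (hle _).trans hpq'
        · exact (hle _).trans hp'v
        · exact (hle _).trans hpp₀
    _ = _ := by ring

/-- The previous estimate at the scale `t`, made homogeneous in `v`. -/
lemma norm_normal_le_mul_of_near (hκ : 0 < κ) (h₁ : IsTangentField κ d M₁ T₁)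
    (h₂ : IsTangentField κ d M₂ T₂) {ε s t : ℝ} (ht : 0 < t)
    (hM : ∀ p ∈ M₁, ∃ q ∈ M₂, dist p q ≤ ε) {p q v : E} (hp : p ∈ M₁) (hq : q ∈ M₂)
    (hpq : dist p q ≤ s) (hv : v ∈ T₁ p) :
    ‖(T₂ q)ᗮ.starProjection v‖ ≤ ‖v‖ / t * (2 * ε + 2 * t ^ 2 / κ +
      ((s + ε) ^ 2 + (ε + 2 * t ^ 2 / κ + t + s) ^ 2) / (2 * κ)) := by
  rcases eq_or_ne v 0 with rfl | hv0
  · simp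
  have hvpos : 0 < ‖v‖ := norm_pos_iff.2 hv0
  have h := norm_normal_le_of_near hκ h₁ h₂ (t := t) hM hp hq hpq
    (Submodule.smul_mem _ (t / ‖v‖) hv)
    (by rw [norm_smul, Real.norm_of_nonneg (by positivity), div_mul_cancel₀ _ hvpos.ne'])
  rw [map_smul, norm_smul, Real.norm_of_nonneg (by positivity)] at h
  calc _ = ‖v‖ / t * (t / ‖v‖ * ‖(T₂ q)ᗮ.starProjection v‖) := by field_simp
    _ ≤ _ := by gcongr

/-- On a ball of radius `κ / 64` about `x ∈ M`, the orthogonal projection of `M` to `T x` shrinks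
distances at most by the factor `2`. -/
lemma norm_sub_le_two_mul_tangential (hκ : 0 < κ) (h : IsTangentField κ d M T) {x p q : E}
    (hx : x ∈ M) (hp : p ∈ M) (hq : q ∈ M) (hpx : dist p x ≤ κ / 64) (hqx : dist q x ≤ κ / 64) :
    ‖q - p‖ ≤ 2 * ‖(T x).starProjection (q - p)‖ := by
  have hqp : ‖q - p‖ ≤ κ / 32 := by
    rw [← dist_eq_norm]
    have := dist_triangle_right q p x
    linarith
  have h1 : ‖(T p)ᗮ.starProjection (q - p)‖ ≤ 1 / 64 * ‖q - p‖ := by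
    refine (h.norm_normal_le p hp q hq).trans ?_
    rw [div_le_iff₀ (by positivity)]
    nlinarith [norm_nonneg (q - p)]
  have h2 := norm_normal_le_mul_of_near hκ h h (ε := 0) (s := κ / 64) (t := κ / 64)
    (by positivity) (fun p hp => ⟨p, hp, by simp⟩) hp hx hpx
    (Submodule.starProjection_apply_mem (T p) (q - p))
  have h3 : ‖(T p).starProjection (q - p)‖ ≤ ‖q - p‖ := Submodule.norm_starProjection_apply_le _ _
  have h4 : ‖(T x)ᗮ.starProjection ((T p).starProjection (q - p))‖ ≤ 1 / 8 * ‖q - p‖ := by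
    refine h2.trans ?_
    have : ∀ y : ℝ, y / (κ / 64) * (2 * 0 + 2 * (κ / 64) ^ 2 / κ +
        ((κ / 64 + 0) ^ 2 + (0 + 2 * (κ / 64) ^ 2 / κ + κ / 64 + κ / 64) ^ 2) / (2 * κ))
        = (1 / 32 + 1 / 128 * (1 + (65 / 32) ^ 2)) * y := by
      intro y; field_simp; ring
    rw [this]
    nlinarith [norm_nonneg (q - p)]
  have h5 : ‖(T x)ᗮ.starProjection (q - p)‖ ≤ 1 / 2 * ‖q - p‖ := by
    have e : (T x)ᗮ.starProjection (q - p) = (T x)ᗮ.starProjection ((T p).starProjection (q - p))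
        + (T x)ᗮ.starProjection ((T p)ᗮ.starProjection (q - p)) := by
      rw [← map_add, starProjection_add_orthogonal]
    rw [e]
    refine (norm_add_le _ _).trans ?_
    have := Submodule.norm_starProjection_apply_le (T x)ᗮ ((T p)ᗮ.starProjection (q - p))
    linarith [norm_nonneg (q - p)]
  have h6 : ‖q - p‖ ≤ ‖(T x).starProjection (q - p)‖ + ‖(T x)ᗮ.starProjection (q - p)‖ := by
    conv_lhs => rw [← starProjection_add_orthogonal (T x) (q - p)]
    exact norm_add_le _ _
  linarith

lemma card_le_of_separated_of_local (hκ : 0 < κ) (h : IsTangentField κ d M T) {x : E} (hx : x ∈ M)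
    {δ : ℝ} (hδ : 0 < δ) (hδκ : δ ≤ κ) {s : Finset E} (hsM : (s : Set E) ⊆ M)
    (hsx : ∀ y ∈ s, dist y x ≤ κ / 64)
    (hsep : ∀ y ∈ s, ∀ z ∈ s, y ≠ z → δ ≤ dist y z) :
    (s.card : ℝ) ≤ (2 * κ / δ) ^ d := by
  classical
  let f : E → T x := (T x).orthogonalProjectionOnto
  have hf : ∀ y z, dist (f y) (f z) = ‖(T x).starProjection (y - z)‖ := by
    intro y z
    rw [dist_eq_norm]
    simp only [f]
    rw [← map_sub]
    rfl
  have hfs : ∀ y ∈ s, ∀ z ∈ s, y ≠ z → δ / 2 ≤ dist (f y) (f z) := by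
    intro y hy z hz hyz
    have h1 := h.norm_sub_le_two_mul_tangential hκ hx (hsM hz) (hsM hy) (hsx z hz) (hsx y hy)
    have h2 := hsep y hy z hz hyz
    rw [dist_eq_norm] at h2
    rw [hf]
    linarith
  have hinj : Set.InjOn f s := by
    intro y hy z hz hyz
    by_contra hne
    have := hfs y hy z hz hne
    rw [hyz, dist_self] at this
    linarith
  have hcard : (s.image f).card = s.card := Finset.card_image_of_injOn hinj
  have h1 := card_le_of_pairwise_le_dist (s := s.image f) (x := f x) (R := κ / 64) (r := δ / 2)
    (by positivity) (by positivity)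
    (by
      intro y hy
      obtain ⟨z, hz, rfl⟩ := Finset.mem_image.1 hy
      rw [hf]
      refine (Submodule.norm_starProjection_apply_le _ _).trans ?_
      rw [← dist_eq_norm]
      exact hsx z hz)
    (by
      intro y hy z hz hyz
      obtain ⟨y', hy', rfl⟩ := Finset.mem_image.1 hy
      obtain ⟨z', hz', rfl⟩ := Finset.mem_image.1 hz
      exact hfs y' hy' z' hz' fun e => hyz (by rw [e]))
  rw [hcard] at h1
  have h1δ : 1 ≤ κ / δ := by rwa [one_le_div hδ]
  have hbase : 2 * (κ / 64) / (δ / 2) + 1 ≤ 2 * κ / δ := by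
    have e1 : 2 * (κ / 64) / (δ / 2) = 1 / 16 * (κ / δ) := by field_simp; norm_num
    have e2 : 2 * κ / δ = 2 * (κ / δ) := by ring
    rw [e1, e2]
    linarith
  calc (s.card : ℝ) ≤ _ := h1
    _ ≤ (2 * κ / δ) ^ finrank ℝ (T x) := by gcongr
    _ ≤ (2 * κ / δ) ^ d := by
        refine pow_le_pow_right₀ ?_ (h.finrank_le x hx)
        rw [mul_div_assoc]; linarith

lemma card_le_of_separated (hκ : 0 < κ) (h : IsTangentField κ d M T) {L : ℝ} (hL : 0 ≤ L) {x₀ : E}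
    (hML : M ⊆ closedBall x₀ L) {δ : ℝ} (hδ : 0 < δ) (hδκ : δ ≤ κ) {s : Finset E}
    (hsM : (s : Set E) ⊆ M) (hsep : ∀ y ∈ s, ∀ z ∈ s, y ≠ z → δ ≤ dist y z) :
    (s.card : ℝ) ≤ (128 * L / κ + 1) ^ finrank ℝ E * (2 * κ / δ) ^ d := by
  classical
  obtain ⟨c, hcM, hccard, hcov⟩ := exists_finset_net_of_subset_closedBall
    (r := κ / 64) (by positivity) hL hML
  have hsub : s ⊆ c.biUnion fun x => s.filter fun y => dist y x ≤ κ / 64 := by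
    intro y hy
    obtain ⟨x, hx, hyx⟩ := hcov y (hsM hy)
    exact Finset.mem_biUnion.2 ⟨x, hx, Finset.mem_filter.2 ⟨hy, hyx⟩⟩
  have h0 : (s.card : ℝ) ≤ ∑ x ∈ c, ((s.filter fun y => dist y x ≤ κ / 64).card : ℝ) := by
    exact_mod_cast (Finset.card_le_card hsub).trans Finset.card_biUnion_le
  have h1 : ∀ x ∈ c, ((s.filter fun y => dist y x ≤ κ / 64).card : ℝ) ≤ (2 * κ / δ) ^ d := by
    intro x hx
    refine h.card_le_of_separated_of_local hκ (hcM hx) hδ hδκ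
      (fun y hy => hsM (Finset.filter_subset _ _ hy)) (fun y hy => (Finset.mem_filter.1 hy).2)
      fun y hy z hz => hsep y (Finset.filter_subset _ _ hy) z (Finset.filter_subset _ _ hz)
  calc (s.card : ℝ) ≤ ∑ x ∈ c, (2 * κ / δ) ^ d := h0.trans (Finset.sum_le_sum h1)
    _ = c.card * (2 * κ / δ) ^ d := by rw [Finset.sum_const, nsmul_eq_mul]
    _ ≤ (2 * L / (κ / 64) + 1) ^ finrank ℝ E * (2 * κ / δ) ^ d := by gcongr
    _ = _ := by
        congr 3
        field_simp
        ring

end IsTangentField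

end Angle

/-! ### Coding and covers at dyadic scales -/

section Coding

/-- A set whose points are determined up to `r` by a code has an `r`-cover by as many of its own
points as there are codes. -/
lemma exists_finset_cover_of_code {X Y : Type*} [PseudoMetricSpace X] {A : Set X} {r : ℝ}
    (code : X → Y) (F : Finset Y) (hF : ∀ x ∈ A, code x ∈ F)
    (h : ∀ x ∈ A, ∀ y ∈ A, code x = code y → dist x y ≤ r) :
    ∃ C : Finset X, (C : Set X) ⊆ A ∧ C.card ≤ F.card ∧ ∀ x ∈ A, ∃ y ∈ C, dist x y ≤ r := by
  classical
  rcases A.eq_empty_or_nonempty with rfl | ⟨x₀, -⟩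
  · exact ⟨∅, by simp⟩
  have : Nonempty X := ⟨x₀⟩
  have hG : ∀ f ∈ F.filter fun f => ∃ x ∈ A, code x = f, ∃ x ∈ A, code x = f :=
    fun f hf => (Finset.mem_filter.1 hf).2
  choose! rep hrep hcode using hG
  refine ⟨(F.filter fun f => ∃ x ∈ A, code x = f).image rep, ?_,
    Finset.card_image_le.trans (Finset.card_filter_le _ _), fun x hx => ?_⟩
  · intro y hy
    obtain ⟨f, hf, rfl⟩ := Finset.mem_image.1 (Finset.mem_coe.1 hy)
    exact hrep f hf
  · have hx' : code x ∈ F.filter fun f => ∃ x ∈ A, code x = f :=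
      Finset.mem_filter.2 ⟨hF x hx, x, hx, rfl⟩
    exact ⟨rep (code x), Finset.mem_image_of_mem _ hx',
      h x hx _ (hrep _ hx') (hcode _ hx').symm⟩

lemma two_pow_le_exp (n : ℕ) : (2 : ℝ) ^ n ≤ Real.exp n := by
  have h : (2 : ℝ) ≤ Real.exp 1 := by
    have := Real.add_one_le_exp 1
    linarith
  calc (2 : ℝ) ^ n ≤ Real.exp 1 ^ n := by gcongr
    _ = Real.exp n := by rw [← Real.exp_nat_mul, mul_one]

open TopologicalSpace

lemma exists_dist_le_of_dist_le {X : Type*} [MetricSpace X] {M M' : NonemptyCompacts X} {r : ℝ}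
    (h : dist M M' ≤ r) {x : X} (hx : x ∈ (M : Set X)) :
    ∃ y ∈ (M' : Set X), dist x y ≤ r := by
  obtain ⟨y, hy, hxy⟩ := M'.isCompact.exists_infDist_eq_dist M'.nonempty x
  refine ⟨y, hy, ?_⟩
  rw [← hxy]
  refine le_trans ?_ h
  rw [NonemptyCompacts.dist_eq]
  exact infDist_le_hausdorffDist_of_mem hx (hausdorffEDist_ne_top_of_nonempty_of_bounded M.nonempty
    M'.nonempty M.isCompact.isBounded M'.isCompact.isBounded)

variable {E : Type*} [NormedAddCommGroup E] [InnerProductSpace ℝ E] [FiniteDimensional ℝ E]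

/-- If `q` and `q' ∈ M` lie in the same cell at `x`, some point of `M` lies within `ε / 2` of `q`,
where `ε = δ ^ 2 / κ`: move from `q'` by the component of `q - q'` tangent to `M`. The normal
component is at most `85 / 256 * ε`, and the error of the move at most `1 / 8 * ε`. -/
lemma IsTangentField.exists_dist_le_half {κ δ : ℝ} {d : ℕ} {M₀ M : Set E}
    {T₀ T : E → Submodule ℝ E} (hκ : 0 < κ) (hδ : 0 < δ) (hδκ : δ ≤ κ)
    (h₀ : IsTangentField κ d M₀ T₀) (h : IsTangentField κ d M T)
    (hM : ∀ p ∈ M₀, ∃ q ∈ M, dist p q ≤ δ ^ 2 / κ) {x q q' : E} (hx : x ∈ M₀) (hq' : q' ∈ M)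
    (hxq' : dist q' x ≤ 2 * δ) (hP : ‖(T₀ x).starProjection (q - q')‖ ≤ δ / 128)
    (hN : ‖(T₀ x)ᗮ.starProjection (q - q')‖ ≤ δ ^ 2 / κ / 8) :
    ∃ p ∈ M, dist q p ≤ δ ^ 2 / κ / 2 := by
  set ε := δ ^ 2 / κ with hε
  have hε0 : 0 < ε := by positivity
  have hεδ : ε ≤ δ := by
    rw [hε, div_le_iff₀ hκ]; nlinarith
  set u := q - q' with hu
  have hangle := norm_normal_le_mul_of_near hκ h₀ h (s := 2 * δ) (t := δ) hδ hM hx hq'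
    (by rw [dist_comm]; exact hxq') (Submodule.starProjection_apply_mem (T₀ x) u)
  have hbound : 2 * ε + 2 * δ ^ 2 / κ +
      ((2 * δ + ε) ^ 2 + (ε + 2 * δ ^ 2 / κ + δ + 2 * δ) ^ 2) / (2 * κ) ≤ 53 / 2 * ε := by
    have e1 : 2 * δ ^ 2 / κ = 2 * ε := by rw [hε]; ring
    rw [e1]
    have e2 : (2 * δ + ε) ^ 2 ≤ (3 * δ) ^ 2 := by gcongr; linarith
    have e3 : (ε + 2 * ε + δ + 2 * δ) ^ 2 ≤ (6 * δ) ^ 2 := by gcongr; linarith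
    have e4 : ((2 * δ + ε) ^ 2 + (ε + 2 * ε + δ + 2 * δ) ^ 2) / (2 * κ)
        ≤ ((3 * δ) ^ 2 + (6 * δ) ^ 2) / (2 * κ) := by gcongr
    have e5 : ((3 * δ) ^ 2 + (6 * δ) ^ 2) / (2 * κ) = 45 / 2 * ε := by
      rw [hε]; field_simp; norm_num
    linarith
  have h1 : ‖(T q')ᗮ.starProjection ((T₀ x).starProjection u)‖ ≤ 53 / 256 * ε := by
    refine hangle.trans ?_
    have e1 : ‖(T₀ x).starProjection u‖ / δ ≤ 1 / 128 := by
      rw [div_le_iff₀ hδ]; linarith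
    calc _ ≤ 1 / 128 * (53 / 2 * ε) := by gcongr
      _ = _ := by ring
  have h2 : ‖(T q')ᗮ.starProjection u‖ ≤ 85 / 256 * ε := by
    have e : (T q')ᗮ.starProjection u = (T q')ᗮ.starProjection ((T₀ x).starProjection u)
        + (T q')ᗮ.starProjection ((T₀ x)ᗮ.starProjection u) := by
      rw [← map_add, starProjection_add_orthogonal]
    rw [e]
    refine (norm_add_le _ _).trans ?_
    have := Submodule.norm_starProjection_apply_le (T q')ᗮ ((T₀ x)ᗮ.starProjection u)
    linarith
  have h3 : ‖u‖ ≤ 17 / 128 * δ := by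
    have : ‖u‖ ≤ ‖(T₀ x).starProjection u‖ + ‖(T₀ x)ᗮ.starProjection u‖ := by
      conv_lhs => rw [← starProjection_add_orthogonal (T₀ x) u]
      exact norm_add_le _ _
    linarith
  obtain ⟨p, hp, hpv⟩ := h.exists_near q' hq' _ (Submodule.starProjection_apply_mem (T q') u)
  refine ⟨p, hp, ?_⟩
  have h4 : ‖p - (q' + (T q').starProjection u)‖ ≤ 1 / 8 * ε := by
    refine hpv.trans ?_
    have : ‖(T q').starProjection u‖ ≤ 17 / 128 * δ :=
      (Submodule.norm_starProjection_apply_le _ _).trans h3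
    calc 2 * ‖(T q').starProjection u‖ ^ 2 / κ ≤ 2 * (17 / 128 * δ) ^ 2 / κ := by gcongr
      _ = 289 / 8192 * ε := by rw [hε]; ring
      _ ≤ _ := by linarith
  have h5 : q - p = (T q')ᗮ.starProjection u - (p - (q' + (T q').starProjection u)) := by
    rw [eq_sub_iff_add_eq'.2 (starProjection_add_orthogonal (T q') u), hu]
    abel
  rw [dist_eq_norm, h5]
  refine (norm_sub_le _ _).trans ?_
  linarith

/-- The exponent in the bound for the size of a cover at the scale `κ`. Multiplied by `(κ / δ) ^ d`,
it also bounds the logarithm of the number of codes at the scale `δ`. The three factors come from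
the net of the ball of radius `L`, from the net of the manifold, and from the cells. -/
noncomputable def entropyConst (κ L : ℝ) (d D : ℕ) : ℝ :=
  ((128 * L / κ + 1) * 2 ^ d * (1025 * 49)) ^ D

variable {κ L : ℝ} {d : ℕ} {x₀ : E} {A : Set (NonemptyCompacts E)}

/-- Passing from the scale `δ ^ 2 / κ` to half of it. -/
lemma exists_cover_half_of_ball (hκ : 0 < κ) (hL : 0 ≤ L) (hD : 1 ≤ finrank ℝ E)
    (hA : ∀ M ∈ A, ∃ T, IsTangentField κ d (M : Set E) T)
    (hAL : ∀ M ∈ A, (M : Set E) ⊆ closedBall x₀ L) {δ : ℝ} (hδ : 0 < δ) (hδκ : δ ≤ κ)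
    {M₀ : NonemptyCompacts E} (hM₀ : M₀ ∈ A) :
    ∃ C : Finset (NonemptyCompacts E), (C : Set (NonemptyCompacts E)) ⊆ A ∧
      (C.card : ℝ) ≤ Real.exp (entropyConst κ L d (finrank ℝ E) * (κ / δ) ^ d) ∧
      ∀ M ∈ A, dist M M₀ ≤ δ ^ 2 / κ → ∃ M' ∈ C, dist M M' ≤ δ ^ 2 / κ / 2 := by
  classical
  set ε := δ ^ 2 / κ with hε
  have hε0 : 0 < ε := by positivity
  have hεδ : ε ≤ δ := by
    rw [hε, div_le_iff₀ hκ]; nlinarith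
  obtain ⟨T₀, hT₀⟩ := hA M₀ hM₀
  obtain ⟨I, hIM, hIcard, hIcov⟩ := exists_finset_net (A := (M₀ : Set E)) hδ
    fun s hs hsep => hT₀.card_le_of_separated hκ hL (hAL M₀ hM₀) hδ hδκ hs hsep
  obtain ⟨W₁, -, hW₁card, hW₁cov⟩ := exists_finset_net_of_subset_closedBall
    (A := closedBall (0 : E) (2 * δ)) (r := δ / 256) (by positivity) (by positivity) subset_rfl
  obtain ⟨W₂, -, hW₂card, hW₂cov⟩ := exists_finset_net_of_subset_closedBall
    (A := closedBall (0 : E) (3 / 2 * ε)) (r := ε / 16) (by positivity) (by positivity) subset_rfl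
  have e₁ : 2 * (2 * δ) / (δ / 256) + 1 = 1025 := by field_simp; norm_num
  have e₂ : 2 * (3 / 2 * ε) / (ε / 16) + 1 = 49 := by field_simp; norm_num
  rw [e₁] at hW₁card
  rw [e₂] at hW₂card
  let R : NonemptyCompacts E → E × E × E → Prop := fun M w => ∃ q ∈ (M : Set E),
    dist q w.1 ≤ 2 * δ ∧ dist ((T₀ w.1).starProjection (q - w.1)) w.2.1 ≤ δ / 256 ∧
      dist ((T₀ w.1)ᗮ.starProjection (q - w.1)) w.2.2 ≤ ε / 16
  let code : NonemptyCompacts E → Finset (E × E × E) := fun M => (I ×ˢ W₁ ×ˢ W₂).filter (R M)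
  have hcode : ∀ M, dist M M₀ ≤ ε → ∀ q ∈ (M : Set E), ∃ w ∈ code M,
      dist q w.1 ≤ 2 * δ ∧ dist ((T₀ w.1).starProjection (q - w.1)) w.2.1 ≤ δ / 256 ∧
      dist ((T₀ w.1)ᗮ.starProjection (q - w.1)) w.2.2 ≤ ε / 16 := by
    intro M hM q hq
    obtain ⟨y, hy, hqy⟩ := exists_dist_le_of_dist_le hM hq
    obtain ⟨x, hx, hyx⟩ := hIcov y hy
    have hqx : dist q x ≤ 2 * δ := by
      have := dist_triangle q y x
      linarith
    have h1 : ‖(T₀ x).starProjection (q - x)‖ ≤ 2 * δ :=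
      (Submodule.norm_starProjection_apply_le _ _).trans (by rwa [← dist_eq_norm])
    have h2 : ‖(T₀ x)ᗮ.starProjection (q - x)‖ ≤ 3 / 2 * ε := by
      have e : q - x = (q - y) + (y - x) := by abel
      rw [e, map_add]
      refine (norm_add_le _ _).trans ?_
      have h3 := Submodule.norm_starProjection_apply_le (T₀ x)ᗮ (q - y)
      have h4 := hT₀.norm_normal_le x (hIM hx) y hy
      rw [dist_eq_norm] at hqy hyx
      have h5 : ‖y - x‖ ^ 2 / (2 * κ) ≤ 1 / 2 * ε := by
        calc ‖y - x‖ ^ 2 / (2 * κ) ≤ δ ^ 2 / (2 * κ) := by gcongr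
          _ = 1 / 2 * ε := by rw [hε]; field_simp
      linarith
    obtain ⟨w₁, hw₁, hd₁⟩ := hW₁cov _ (mem_closedBall_zero_iff.2 h1)
    obtain ⟨w₂, hw₂, hd₂⟩ := hW₂cov _ (mem_closedBall_zero_iff.2 h2)
    refine ⟨(x, w₁, w₂), Finset.mem_filter.2 ⟨?_, q, hq, hqx, hd₁, hd₂⟩, hqx, hd₁, hd₂⟩
    simp [hx, hw₁, hw₂]
  have hhalf : ∀ M, dist M M₀ ≤ ε → ∀ M' ∈ A, dist M' M₀ ≤ ε → code M = code M' →
      ∀ q ∈ (M : Set E), ∃ p ∈ (M' : Set E), dist q p ≤ ε / 2 := by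
    intro M hM M' hM'A hM' hMM' q hq
    obtain ⟨w, hw, -, hqP, hqN⟩ := hcode M hM q hq
    rw [hMM'] at hw
    obtain ⟨hwm, q', hq', hqx', hqP', hqN'⟩ := Finset.mem_filter.1 hw
    obtain ⟨T', hT'⟩ := hA M' hM'A
    have hwI : w.1 ∈ I := (Finset.mem_product.1 hwm).1
    have e : q - q' = (q - w.1) - (q' - w.1) := by abel
    refine hT₀.exists_dist_le_half hκ hδ hδκ hT'
      (fun p hp => exists_dist_le_of_dist_le (by rwa [dist_comm]) hp) (hIM hwI) hq' hqx' ?_ ?_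
    · rw [e, map_sub, ← dist_eq_norm]
      refine (dist_triangle_right _ _ w.2.1).trans ?_
      linarith
    · rw [e, map_sub, ← dist_eq_norm]
      refine (dist_triangle_right _ _ w.2.2).trans ?_
      linarith
  obtain ⟨C, hCA, hCcard, hCcov⟩ := exists_finset_cover_of_code
    (A := {M | M ∈ A ∧ dist M M₀ ≤ ε}) (r := ε / 2) code (I ×ˢ W₁ ×ˢ W₂).powerset
    (fun M _ => Finset.mem_powerset.2 (Finset.filter_subset _ _))
    (fun M hM M' hM' hMM' => by
      rw [NonemptyCompacts.dist_eq]
      exact hausdorffDist_le_of_mem_dist (by positivity)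
        (hhalf M hM.2 M' hM'.1 hM'.2 hMM') (hhalf M' hM'.2 M hM.1 hM.2 hMM'.symm))
  refine ⟨C, fun M hM => (hCA hM).1, ?_, fun M hM hd => hCcov M ⟨hM, hd⟩⟩
  rw [Finset.card_powerset] at hCcard
  have h1 : (C.card : ℝ) ≤ 2 ^ (I ×ˢ W₁ ×ˢ W₂).card := by exact_mod_cast hCcard
  refine h1.trans ((two_pow_le_exp _).trans (Real.exp_le_exp.2 ?_))
  rw [Finset.card_product, Finset.card_product]
  push_cast
  set D := finrank ℝ E
  have h2d : (2 : ℝ) ^ d ≤ (2 ^ d) ^ D :=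
    le_self_pow₀ (one_le_pow₀ (by norm_num)) (by omega)
  calc (I.card : ℝ) * (W₁.card * W₂.card)
      ≤ ((128 * L / κ + 1) ^ D * (2 * κ / δ) ^ d) * (1025 ^ D * 49 ^ D) := by gcongr
    _ = (128 * L / κ + 1) ^ D * 2 ^ d * (1025 ^ D * 49 ^ D) * (κ / δ) ^ d := by
        rw [mul_div_assoc 2 κ δ, mul_pow]; ring
    _ ≤ (128 * L / κ + 1) ^ D * (2 ^ d) ^ D * (1025 ^ D * 49 ^ D) * (κ / δ) ^ d := by gcongr
    _ = _ := by rw [entropyConst, mul_pow, mul_pow, mul_pow]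

/-- The coarsest scale: the code of `M` is the set of points of a `κ / 2`-net of the ball that are
close to `M`. -/
lemma exists_cover_of_subset_closedBall (hκ : 0 < κ) (hL : 0 ≤ L)
    (hAL : ∀ M ∈ A, (M : Set E) ⊆ closedBall x₀ L) :
    ∃ C : Finset (NonemptyCompacts E), (C : Set (NonemptyCompacts E)) ⊆ A ∧
      (C.card : ℝ) ≤ Real.exp (entropyConst κ L d (finrank ℝ E)) ∧
      ∀ M ∈ A, ∃ M' ∈ C, dist M M' ≤ κ := by
  classical
  obtain ⟨W, -, hWcard, hWcov⟩ := exists_finset_net_of_subset_closedBall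
    (A := closedBall x₀ L) (r := κ / 2) (by positivity) hL subset_rfl
  let code : NonemptyCompacts E → Finset E :=
    fun M => W.filter fun w => ∃ q ∈ (M : Set E), dist q w ≤ κ / 2
  have hhalf : ∀ M ∈ A, ∀ M', code M = code M' →
      ∀ q ∈ (M : Set E), ∃ p ∈ (M' : Set E), dist q p ≤ κ := by
    intro M hM M' hMM' q hq
    obtain ⟨w, hw, hqw⟩ := hWcov q (hAL M hM hq)
    have hwc : w ∈ code M := Finset.mem_filter.2 ⟨hw, q, hq, hqw⟩
    rw [hMM'] at hwc
    obtain ⟨-, q', hq', hqw'⟩ := Finset.mem_filter.1 hwc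
    refine ⟨q', hq', (dist_triangle_right _ _ w).trans ?_⟩
    linarith
  obtain ⟨C, hCA, hCcard, hCcov⟩ := exists_finset_cover_of_code (A := A) (r := κ) code W.powerset
    (fun M _ => Finset.mem_powerset.2 (Finset.filter_subset _ _))
    (fun M hM M' hM' hMM' => by
      rw [NonemptyCompacts.dist_eq]
      exact hausdorffDist_le_of_mem_dist hκ.le (hhalf M hM M' hMM') (hhalf M' hM' M hMM'.symm))
  refine ⟨C, hCA, ?_, hCcov⟩
  rw [Finset.card_powerset] at hCcard
  have h1 : (C.card : ℝ) ≤ 2 ^ W.card := by exact_mod_cast hCcard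
  refine h1.trans ((two_pow_le_exp _).trans (Real.exp_le_exp.2 (hWcard.trans ?_)))
  rw [entropyConst]
  have hLκ : 0 ≤ L / κ := by positivity
  have e1 : 2 * L / (κ / 2) + 1 ≤ 128 * L / κ + 1 := by
    have : 2 * L / (κ / 2) = 4 * (L / κ) := by field_simp; ring
    rw [this, mul_div_assoc]
    linarith
  have e2 : (1 : ℝ) ≤ 2 ^ d * (1025 * 49) := by
    have : (1 : ℝ) ≤ 2 ^ d := one_le_pow₀ (by norm_num)
    linarith
  have e3 : 0 ≤ 128 * L / κ + 1 := by positivity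
  gcongr
  rw [mul_assoc]
  exact e1.trans (le_mul_of_one_le_right e3 e2)

theorem exists_cover_dyadic (hκ : 0 < κ) (hL : 0 ≤ L) (hd : 1 ≤ d) (hD : 1 ≤ finrank ℝ E)
    (hA : ∀ M ∈ A, ∃ T, IsTangentField κ d (M : Set E) T)
    (hAL : ∀ M ∈ A, (M : Set E) ⊆ closedBall x₀ L) (k : ℕ) :
    ∃ C : Finset (NonemptyCompacts E), (C : Set (NonemptyCompacts E)) ⊆ A ∧
      (C.card : ℝ) ≤ Real.exp (4 * entropyConst κ L d (finrank ℝ E) * (√2 ^ k) ^ d) ∧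
      ∀ M ∈ A, ∃ M' ∈ C, dist M M' ≤ κ / 2 ^ k := by
  classical
  set B := entropyConst κ L d (finrank ℝ E) with hB
  have hB0 : 0 ≤ B := by rw [hB, entropyConst]; positivity
  have hs1 : 5 / 4 ≤ √2 := Real.le_sqrt_of_sq_le (by norm_num)
  have hs2 : √2 ^ 2 = 2 := Real.sq_sqrt (by norm_num)
  induction k with
  | zero =>
    obtain ⟨C, hC, hcard, hcov⟩ := exists_cover_of_subset_closedBall (d := d) hκ hL hAL
    refine ⟨C, hC, hcard.trans (Real.exp_le_exp.2 ?_), by simpa using hcov⟩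
    rw [pow_zero, one_pow, ← hB]
    linarith
  | succ k ih =>
    obtain ⟨C, hC, hcard, hcov⟩ := ih
    have hsk : 1 ≤ √2 ^ k := one_le_pow₀ (by linarith)
    have hδ : 0 < κ / √2 ^ k := by positivity
    have hδκ : κ / √2 ^ k ≤ κ := div_le_self hκ.le hsk
    have hε : (κ / √2 ^ k) ^ 2 / κ = κ / 2 ^ k := by
      rw [div_pow, ← pow_mul, mul_comm k 2, pow_mul, hs2]
      field_simp
    have hκδ : κ / (κ / √2 ^ k) = √2 ^ k := by field_simp
    have hstep := fun (M₀ : NonemptyCompacts E) (hM₀ : M₀ ∈ C) =>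
      exists_cover_half_of_ball hκ hL hD hA hAL hδ hδκ (hC hM₀)
    rw [hε, hκδ] at hstep
    choose! S hSA hScard hScov using hstep
    refine ⟨C.biUnion S, ?_, ?_, ?_⟩
    · intro M hM
      obtain ⟨M₀, hM₀, hM⟩ := Finset.mem_biUnion.1 (Finset.mem_coe.1 hM)
      exact hSA M₀ hM₀ hM
    · have h1 : ((C.biUnion S).card : ℝ) ≤ ∑ M₀ ∈ C, ((S M₀).card : ℝ) := by
        exact_mod_cast Finset.card_biUnion_le
      have h2 : ∑ M₀ ∈ C, ((S M₀).card : ℝ) ≤ C.card * Real.exp (B * (√2 ^ k) ^ d) := by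
        rw [← nsmul_eq_mul, ← Finset.sum_const]
        exact Finset.sum_le_sum hScard
      calc ((C.biUnion S).card : ℝ) ≤ C.card * Real.exp (B * (√2 ^ k) ^ d) := h1.trans h2
        _ ≤ Real.exp (4 * B * (√2 ^ k) ^ d) * Real.exp (B * (√2 ^ k) ^ d) := by gcongr
        _ = Real.exp (B * (√2 ^ k) ^ d * 5) := by rw [← Real.exp_add]; congr 1; ring
        _ ≤ _ := by
          rw [Real.exp_le_exp, pow_succ, mul_pow]
          -- the number of bits grows at least by the factor `5 / 4` from one scale to the next,
          -- so that the bits of the new scale fit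
          have h3 : 5 / 4 ≤ √2 ^ d := hs1.trans (le_self_pow₀ (by linarith) (by omega))
          have h4 : 0 ≤ B * (√2 ^ k) ^ d := by positivity
          nlinarith
    · intro M hM
      obtain ⟨M₀, hM₀, hd₀⟩ := hcov M hM
      obtain ⟨M', hM', hd'⟩ := hScov M₀ hM₀ M hM hd₀
      refine ⟨M', Finset.mem_biUnion.2 ⟨M₀, hM₀, hM'⟩, hd'.trans_eq ?_⟩
      rw [pow_succ, div_div]

end Coding

/-! ### The covering number -/

section CoveringNumber

open TopologicalSpace

lemma exists_dyadic_scale {κ γ : ℝ} (hγ : 0 < γ) (hγκ : γ < κ) :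
    ∃ k : ℕ, κ / 2 ^ k ≤ γ ∧ (2 : ℝ) ^ k ≤ 2 * κ / γ := by
  obtain ⟨n, hn, hn'⟩ := exists_nat_pow_near ((one_le_div hγ).2 hγκ.le) one_lt_two
  refine ⟨n + 1, ?_, ?_⟩
  · rw [div_lt_iff₀ hγ] at hn'
    rw [div_le_iff₀ (by positivity)]
    linarith
  · rw [pow_succ, mul_comm, mul_div_assoc]
    gcongr

lemma coveringNumber_le_of_finset {X : Type*} [PseudoMetricSpace X] {A : Set X} {C : Finset X}
    {γ : ℝ≥0} {N : ℝ} (hC : (C : Set X) ⊆ A) (hcard : (C.card : ℝ) ≤ N)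
    (hcov : ∀ x ∈ A, ∃ y ∈ C, dist x y ≤ γ) :
    ((coveringNumber γ A : ℕ∞) : ℝ≥0∞) ≤ ENNReal.ofReal N := by
  have hcover : IsCover γ A (C : Set X) := by
    intro x hx
    obtain ⟨y, hy, hxy⟩ := hcov x hx
    refine ⟨y, hy, ?_⟩
    change edist x y ≤ γ
    rw [edist_nndist]
    exact_mod_cast hxy
  have h1 := hcover.coveringNumber_le_encard hC
  rw [encard_coe_eq_coe_finsetCard] at h1
  calc ((coveringNumber γ A : ℕ∞) : ℝ≥0∞) ≤ ((C.card : ℕ∞) : ℝ≥0∞) := by exact_mod_cast h1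
    _ = ENNReal.ofReal C.card := by simp
    _ ≤ ENNReal.ofReal N := ENNReal.ofReal_le_ofReal hcard

theorem theorem4 :
    ∃ c₁ : ℝ, 0 < c₁ ∧
      ∀ (d : ℕ) (κ L : ℝ), 1 ≤ d → 0 < κ → 0 < L →
        ∃ c₂ : ℝ, 0 < c₂ ∧
          ∀ (D : ℕ) (K : Set (EuclideanSpace ℝ (Fin D))),
            d < D → IsCompact K → Metric.diam K ≤ L →
            ∀ γ : ℝ≥0, 0 < γ →
              ((Metric.coveringNumber γ (manifoldClass d K κ) : ℕ∞) : ℝ≥0∞) ≤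
                ENNReal.ofReal
                  (c₁ * (D.choose d : ℝ) ^ ((c₂ / κ) ^ D) *
                    Real.exp ((2 : ℝ) ^ ((d : ℝ) / 2) * ((D : ℝ) - (d : ℝ)) * (c₂ / κ) ^ D *
                      (γ : ℝ) ^ (-((d : ℝ) / 2)))) := by
  refine ⟨1, one_pos, fun d κ L hd hκ hL => ?_⟩
  set G : ℝ := (128 * L / κ + 1) * 2 ^ d * (1025 * 49) with hG
  set m : ℝ := max 1 κ ^ d with hm
  have hG0 : 0 < G := by positivity
  have hm1 : 1 ≤ m := one_le_pow₀ (le_max_left _ _)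
  have hm0 : 0 < m := by linarith
  refine ⟨κ * (8 * G * m), by positivity, fun D K hdD hK hKL γ hγ => ?_⟩
  rw [mul_div_cancel_left₀ _ hκ.ne', one_mul]
  set A : ℝ := (8 * G * m) ^ D with hA
  have hD0 : D ≠ 0 := by omega
  set B := entropyConst κ L d D with hB
  have hBG : B = G ^ D := rfl
  have hB0 : 0 < B := by rw [hBG]; positivity
  -- as `D ≥ 1`, the factors `8` and `m` in the base of `A` are still there after taking powers
  have hAB : 8 * B * m ≤ A := by
    rw [hA, mul_pow, mul_pow, hBG]
    have h8 : (8 : ℝ) ≤ 8 ^ D := le_self_pow₀ (by norm_num) hD0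
    have hmD : m ≤ m ^ D := le_self_pow₀ hm1 hD0
    gcongr
  have hA0 : 0 < A := by positivity
  have hchoose : (2 : ℝ) ≤ D.choose d := by
    have h1 : D.choose d ≠ 1 := by
      rw [Ne, Nat.choose_eq_one_iff]; omega
    have h2 := Nat.choose_pos hdD.le
    exact_mod_cast (show 2 ≤ D.choose d by omega)
  have hDd : (1 : ℝ) ≤ (D : ℝ) - d := by
    have : ((d + 1 : ℕ) : ℝ) ≤ D := by exact_mod_cast hdD
    push_cast at this
    linarith
  have hγ' : (0 : ℝ) < γ := hγ
  rcases K.eq_empty_or_nonempty with rfl | ⟨x₀, hx₀⟩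
  · have : manifoldClass d (∅ : Set (EuclideanSpace ℝ (Fin D))) κ = ∅ := by
      refine eq_empty_of_forall_notMem fun M hM => ?_
      obtain ⟨x, hx⟩ := M.nonempty
      exact hM.1 hx
    simp [this]
  have hfin : finrank ℝ (EuclideanSpace ℝ (Fin D)) = D := by simp
  have hcov := exists_cover_dyadic (κ := κ) (L := L) (d := d) (x₀ := x₀)
    (A := manifoldClass d K κ) hκ hL.le hd (by omega)
    (fun M hM => exists_isTangentField hκ hM)
    (fun M hM x hx => (dist_le_diam_of_mem hK.isBounded (hM.1 hx) hx₀).trans hKL)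
  rw [hfin, ← hB] at hcov
  rcases le_or_gt κ γ with hκγ | hγκ
  · obtain ⟨C, hC, hcard, hcover⟩ := hcov 0
    refine coveringNumber_le_of_finset hC (hcard.trans ?_) fun M hM => ?_
    · rw [pow_zero, one_pow, mul_one]
      have h2 : Real.exp (1 / 2) ≤ 2 := by
        rw [← Real.le_log_iff_exp_le two_pos]
        linarith [Real.log_two_gt_d9]
      calc Real.exp (4 * B) ≤ Real.exp (1 / 2 * A) := by
            rw [Real.exp_le_exp]; nlinarith
        _ = Real.exp (1 / 2) ^ A := by rw [Real.exp_mul]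
        _ ≤ (D.choose d : ℝ) ^ A := by gcongr; exact h2.trans hchoose
        _ ≤ _ := le_mul_of_one_le_right (by positivity) (Real.one_le_exp (by positivity))
    · obtain ⟨M', hM', hd'⟩ := hcover M hM
      exact ⟨M', hM', hd'.trans (by simpa using hκγ)⟩
  · obtain ⟨k, hk, hk'⟩ := exists_dyadic_scale hγ' hγκ
    obtain ⟨C, hC, hcard, hcover⟩ := hcov k
    refine coveringNumber_le_of_finset hC (hcard.trans ?_) fun M hM => ?_
    · have h1 : (√2 ^ k) ^ d ≤ 2 ^ ((d : ℝ) / 2) * m * (γ : ℝ) ^ (-((d : ℝ) / 2)) := by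
        have e1 : (√2 ^ k) ^ d = ((2 : ℝ) ^ k) ^ ((d : ℝ) / 2) := by
          rw [Real.sqrt_eq_rpow, ← Real.rpow_natCast, ← Real.rpow_natCast, ← Real.rpow_natCast,
            ← Real.rpow_mul two_pos.le, ← Real.rpow_mul two_pos.le, ← Real.rpow_mul two_pos.le]
          congr 1
          ring
        have e2 : κ ^ ((d : ℝ) / 2) ≤ m := by
          rw [hm, ← Real.rpow_natCast]
          calc κ ^ ((d : ℝ) / 2) ≤ max 1 κ ^ ((d : ℝ) / 2) := by
                gcongr; exact le_max_right _ _
            _ ≤ max 1 κ ^ (d : ℝ) := by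
                refine Real.rpow_le_rpow_of_exponent_le (le_max_left _ _) ?_
                have : (0 : ℝ) ≤ d := by positivity
                linarith
        calc (√2 ^ k) ^ d ≤ (2 * κ / γ) ^ ((d : ℝ) / 2) := by rw [e1]; gcongr
          _ = 2 ^ ((d : ℝ) / 2) * κ ^ ((d : ℝ) / 2) * (γ : ℝ) ^ (-((d : ℝ) / 2)) := by
              rw [Real.div_rpow (by positivity) hγ'.le, Real.mul_rpow two_pos.le hκ.le,
                Real.rpow_neg hγ'.le, div_eq_mul_inv]
          _ ≤ _ := by gcongr
      set g := (γ : ℝ) ^ (-((d : ℝ) / 2))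
      set t := (2 : ℝ) ^ ((d : ℝ) / 2)
      have hg0 : 0 ≤ g := by positivity
      have ht0 : 0 ≤ t := by positivity
      calc Real.exp (4 * B * (√2 ^ k) ^ d) ≤ Real.exp (t * (D - d) * A * g) := by
            rw [Real.exp_le_exp]
            calc 4 * B * (√2 ^ k) ^ d ≤ 4 * B * (t * m * g) := by gcongr
              _ = t * 1 * (4 * B * m) * g := by ring
              _ ≤ t * (D - d) * A * g := by
                have : 4 * B * m ≤ A := by nlinarith [mul_pos hB0 hm0]
                gcongr
        _ ≤ _ := le_mul_of_one_le_left (by positivity)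
            (Real.one_le_rpow (by linarith) hA0.le)
    · obtain ⟨M', hM', hd'⟩ := hcover M hM
      exact ⟨M', hM', hd'.trans hk⟩

end CoveringNumber
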